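/- **Conventions.** Let $K$ be a commutative ring (for instance a field). Algebras are associative unital $K$-algebras, and an $(A,B)$-bimodule is a left $A$-, right $B$-module with commuting actions that induce the same action of $K$. Let $\mathcal A$ be a class of two-sided noetherian $K$-algebras such that $A\in\mathcal A$ if and only if $A^{\mathrm{op}}\in\mathcal A$. Let $\partial$ assign to every left and every right module $M$ over an algebra in $\mathcal A$ a value $\partial(M)\in\mathbb R_{\ge 0}\cup\{\pm\infty\}$ depending only on the isomorphism class of $M$, and write $\partial(A):=\partial(A_A)$. **Hypothesis (H).** For all $A,B\in\mathcal A$: 1. $\partial$ is an exact dimension function on left and on right $A$-modules: $\partial(M)=-\infty$ if and only if $M=0$; $\partial(M)=\max\{\partial(N),\partial(M/N)\}$ for every submodule $N\subseteq M$; and $\partial(\bigcup_i M_i)=\sup_i\partial(M_i)$ for every directed system of submodules $M_i$ of $M$. 2. $\partial(A)\in\mathbb N$. 3. For every $(A,B)$-bimodule $M$: if $M_B$ is finitely generated then $\partial({}_AM)\le\partial(M_B)$, and if ${}_AM$ is finitely generated then $\partial(M_B)\le\partial({}_AM)$. 4. If $\partial(A)=\partial(B)=d$, then $\gamma_{d-2,1}(A,B)$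 holds: for every $(A,B)$-bimodule $M$ that is finitely generated on both sides and $j=0,1$, $\mathrm{Tor}^A_j(N,M)$ is a finitely generated right $B$-module of dimension $\le d-2$ for every finitely generated right $A$-module $N$ with $\partial(N)\le d-2$, and $\mathrm{Tor}^B_j(M,N)$ is a finitely generated left $A$-module of dimension $\le d-2$ for every finitely generated left $B$-module $N$ with $\partial(N)\le d-2$. **Definitions.** Two $(D,A)$-bimodules $X,Y$ are *$n$-isomorphic*, $X\cong_n Y$, if there are a $(D,A)$-bimodule $P$ and bimodule maps $X\to P$ and $Y\to P$ whose kernels and cokernels, as right $A$-modules, have dimension $\le n$. (If $n<0$ this means that they are zero.) The grade of an $A$-module $M$ is $j(M)=\inf\{i:\mathrm{Ext}^i_A(M,A)\ne0\}\in\mathbb N\cup\{\infty\}$. An algebra $B$ is *Auslander regular* if $\operatorname{gldim}B<\infty$ and, for every finitely generated left or right $B$-module $M$ and every $q\ge0$, every $B$-submodule $N$ of $\mathrm{Ext}^q_B(M,B)$ has $j(N)\ge q$. It is *$\partial$-Cohen–Macaulay* if $\partial(B)\in\mathbb N$ and $j(M)+\partial(M)=\partial(B)$ for every nonzero finitely generated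 left or right $B$-module $M$. Let $A\in\mathcal A$ and $d=\partial(A)$. A *noncommutative quasi-resolution* (NQR) of $A$ is a triple $(B,{}_BM_A,{}_AN_B)$ in which $B\in\mathcal A$ is Auslander regular and $\partial$-Cohen–Macaulay with $\partial(B)=d$, and $M,N$ are bimodules, finitely generated on both sides, such that $$M\otimes_AN\cong_{d-2}B\quad\text{and}\quad N\otimes_BM\cong_{d-2}A$$ as bimodules. **Theorem 4.2.** Assume (H). Let $A\in\mathcal A$ with $\partial(A)\le 2$, and let $(B_1,M_1,N_1)$ and $(B_2,M_2,N_2)$ be two NQRs of $A$. Then $B_1$ and $B_2$ are Morita equivalent, that is, their module categories are equivalent as $K$-linear categories. -/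

import Mathlib

open CategoryTheory MulOpposite
open scoped TensorProduct

universe v u

/-! Conventions. A left `A`-module is a `Module A M`; a right `A`-module is a `Module Aᵐᵒᵖ M`, with
`x · a` written `op a • x`. An algebra is regarded as a right module over itself through Mathlib's
instance `Module Aᵐᵒᵖ A`. All algebras, modules and bimodules are over a commutative base ring `K`
(the base field, or a commutative algebra over it if bimodules are to be central over that algebra). -/

/-! ### The balanced tensor product over a noncommutative ring -/

section BalancedTensor

variable (A : Type u) [Ring A]

/-- The subgroup of `M ⊗[ℤ] N` generated by the elements `x · a ⊗ y - x ⊗ a • y`. -/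
def balancedRelations (M N : Type u) [AddCommGroup M] [Module Aᵐᵒᵖ M] [AddCommGroup N]
    [Module A N] : AddSubgroup (M ⊗[ℤ] N) :=
  AddSubgroup.closure {t | ∃ (x : M) (a : A) (y : N), t = (op a • x) ⊗ₜ[ℤ] y - x ⊗ₜ[ℤ] (a • y)}

/-- The tensor product `M ⊗_A N` of a right `A`-module `M` and a left `A`-module `N`. -/
def BalancedTensor (M N : Type u) [AddCommGroup M] [Module Aᵐᵒᵖ M] [AddCommGroup N]
    [Module A N] : Type u :=
  (M ⊗[ℤ] N) ⧸ balancedRelations A M N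

namespace BalancedTensor

variable {M M' M'' N N' N'' : Type u}
  [AddCommGroup M] [Module Aᵐᵒᵖ M] [AddCommGroup M'] [Module Aᵐᵒᵖ M']
  [AddCommGroup M''] [Module Aᵐᵒᵖ M'']
  [AddCommGroup N] [Module A N] [AddCommGroup N'] [Module A N'] [AddCommGroup N''] [Module A N'']

noncomputable instance : AddCommGroup (BalancedTensor A M N) :=
  inferInstanceAs (AddCommGroup ((M ⊗[ℤ] N) ⧸ balancedRelations A M N))

/-- The class of `x ⊗ y` in `M ⊗_A N`. -/
def tmul (x : M) (y : N) : BalancedTensor A M N :=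
  QuotientAddGroup.mk' (balancedRelations A M N) (x ⊗ₜ[ℤ] y)

theorem smul_tmul (x : M) (a : A) (y : N) : tmul A (op a • x) y = tmul A x (a • y) := by
  refine (QuotientAddGroup.eq_iff_sub_mem).2 ?_
  exact AddSubgroup.subset_closure ⟨x, a, y, rfl⟩

theorem induction {p : BalancedTensor A M N → Prop} (zero : p 0)
    (tmul : ∀ x y, p (tmul A x y)) (add : ∀ s t, p s → p t → p (s + t)) (t) : p t := by
  obtain ⟨t, rfl⟩ := QuotientAddGroup.mk'_surjective (balancedRelations A M N) t
  induction t using TensorProduct.induction_on with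
  | zero => rw [map_zero]; exact zero
  | tmul x y => exact tmul x y
  | add s t hs ht => rw [map_add]; exact add _ _ hs ht

theorem hom_ext {G : Type*} [AddCommGroup G] {φ ψ : BalancedTensor A M N →+ G}
    (h : ∀ x y, φ (tmul A x y) = ψ (tmul A x y)) : φ = ψ := by
  ext t
  refine induction A (p := fun t => φ t = ψ t) ?_ h ?_ t
  · simp
  · intro s t hs ht; simp [hs, ht]

/-- The map `f ⊗_A g` induced by a right `A`-linear `f` and a left `A`-linear `g`. -/
noncomputable def map (f : M →ₗ[Aᵐᵒᵖ] M') (g : N →ₗ[A] N') :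
    BalancedTensor A M N →+ BalancedTensor A M' N' :=
  QuotientAddGroup.map _ _
    (TensorProduct.map f.toAddMonoidHom.toIntLinearMap g.toAddMonoidHom.toIntLinearMap).toAddMonoidHom
    (by
      refine (AddSubgroup.closure_le _).2 ?_
      rintro _ ⟨x, a, y, rfl⟩
      refine AddSubgroup.subset_closure ⟨f x, a, g y, ?_⟩
      simp)

@[simp]
theorem map_tmul (f : M →ₗ[Aᵐᵒᵖ] M') (g : N →ₗ[A] N') (x : M) (y : N) :
    map A f g (tmul A x y) = tmul A (f x) (g y) := rfl

theorem tmul_add (x : M) (y y' : N) : tmul A x (y + y') = tmul A x y + tmul A x y' := by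
  simp only [tmul, TensorProduct.tmul_add, map_add]; rfl

theorem add_tmul (x x' : M) (y : N) : tmul A (x + x') y = tmul A x y + tmul A x' y := by
  simp only [tmul, TensorProduct.add_tmul, map_add]; rfl

theorem tmul_zero (x : M) : tmul A x (0 : N) = 0 := by
  simp only [tmul, TensorProduct.tmul_zero, map_zero]; rfl

theorem zero_tmul (y : N) : tmul A (0 : M) y = 0 := by
  simp only [tmul, TensorProduct.zero_tmul, map_zero]; rfl

theorem map_id : map A (LinearMap.id : M →ₗ[Aᵐᵒᵖ] M) (LinearMap.id : N →ₗ[A] N) =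
    AddMonoidHom.id _ :=
  hom_ext A fun _ _ => rfl

theorem map_comp (f' : M' →ₗ[Aᵐᵒᵖ] M'') (f : M →ₗ[Aᵐᵒᵖ] M') (g' : N' →ₗ[A] N'')
    (g : N →ₗ[A] N') :
    map A (f' ∘ₗ f) (g' ∘ₗ g) = (map A f' g').comp (map A f g) :=
  hom_ext A fun _ _ => rfl

theorem map_add_left (f f' : M →ₗ[Aᵐᵒᵖ] M') (g : N →ₗ[A] N') :
    map A (f + f') g = map A f g + map A f' g :=
  hom_ext A fun x y => add_tmul A (f x) (f' x) (g y)

theorem map_add_right (f : M →ₗ[Aᵐᵒᵖ] M') (g g' : N →ₗ[A] N') :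
    map A f (g + g') = map A f g + map A f g' :=
  hom_ext A fun x y => tmul_add A (f x) (g y) (g' y)

/-- Right `A`-linear endomorphisms of `M` act on `M ⊗_A N`. -/
noncomputable def leftEnd : Module.End Aᵐᵒᵖ M →+* AddMonoid.End (BalancedTensor A M N) where
  toFun f := map A f LinearMap.id
  map_one' := hom_ext A fun _ _ => rfl
  map_mul' _ _ := hom_ext A fun _ _ => rfl
  map_zero' := hom_ext A fun _ y => zero_tmul A y
  map_add' f g := hom_ext A fun x y => add_tmul A (f x) (g x) y

/-- Left `A`-linear endomorphisms of `N` act on `M ⊗_A N`. -/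
noncomputable def rightEnd : Module.End A N →+* AddMonoid.End (BalancedTensor A M N) where
  toFun g := map A LinearMap.id g
  map_one' := hom_ext A fun _ _ => rfl
  map_mul' _ _ := hom_ext A fun _ _ => rfl
  map_zero' := hom_ext A fun x _ => tmul_zero A x
  map_add' f g := hom_ext A fun x y => tmul_add A x (f y) (g y)

/-- If `S` acts on `M` compatibly with the right `A`-action, it acts on `M ⊗_A N` by
`s • (x ⊗ y) = (s • x) ⊗ y`. -/
@[reducible]
noncomputable def leftModule (S : Type*) [Ring S] [Module S M] [SMulCommClass S Aᵐᵒᵖ M] :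
    Module S (BalancedTensor A M N) :=
  Module.compHom _ ((leftEnd A (M := M) (N := N)).comp (Module.toModuleEnd Aᵐᵒᵖ (S := S) M))

/-- If `S` acts on `N` compatibly with the left `A`-action, it acts on `M ⊗_A N` by
`s • (x ⊗ y) = x ⊗ (s • y)`. -/
@[reducible]
noncomputable def rightModule (S : Type*) [Ring S] [Module S N] [SMulCommClass S A N] :
    Module S (BalancedTensor A M N) :=
  Module.compHom _ ((rightEnd A (M := M) (N := N)).comp (Module.toModuleEnd A (S := S) N))

end BalancedTensor

end BalancedTensor

/-! ### Bimodules -/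

/-- A `K`-central `(A, B)`-bimodule: a left `A`-module and a right `B`-module whose actions commute
and induce the same action of the base ring `K`. -/
structure CentralBimodule (K : Type v) [CommRing K] (A B : Type u) [Ring A] [Algebra K A] [Ring B]
    [Algebra K B] where
  /-- The underlying type. -/
  carrier : Type u
  [addCommGroup : AddCommGroup carrier]
  [moduleBase : Module K carrier]
  [moduleLeft : Module A carrier]
  [moduleRight : Module Bᵐᵒᵖ carrier]
  [smulComm : SMulCommClass A Bᵐᵒᵖ carrier]
  [towerLeft : IsScalarTower K A carrier]
  [towerRight : IsScalarTower K Bᵐᵒᵖ carrier]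

namespace CentralBimodule

variable {K : Type v} [CommRing K] {A B C : Type u} [Ring A] [Algebra K A] [Ring B] [Algebra K B]
  [Ring C] [Algebra K C]

instance : CoeSort (CentralBimodule K A B) (Type u) := ⟨carrier⟩

attribute [instance] addCommGroup moduleBase moduleLeft moduleRight smulComm towerLeft towerRight

instance (M : CentralBimodule K A B) : SMulCommClass Bᵐᵒᵖ A M := SMulCommClass.symm _ _ _

/-- Finitely generated on both sides. -/
def IsFG (M : CentralBimodule K A B) : Prop := Module.Finite A M ∧ Module.Finite Bᵐᵒᵖ M

/-- The algebra `A` as an `(A, A)`-bimodule. -/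
def regular (K : Type v) [CommRing K] (A : Type u) [Ring A] [Algebra K A] :
    CentralBimodule K A A where
  carrier := A

/-- The tensor product `M ⊗_B N` of an `(A, B)`-bimodule and a `(B, C)`-bimodule,
an `(A, C)`-bimodule. -/
noncomputable def tensor (M : CentralBimodule K A B) (N : CentralBimodule K B C) :
    CentralBimodule K A C :=
  letI : SMulCommClass K Bᵐᵒᵖ M := IsScalarTower.to_smulCommClass
  letI : Module K (BalancedTensor B M N) := BalancedTensor.leftModule B K
  letI : Module A (BalancedTensor B M N) := BalancedTensor.leftModule B A
  letI : Module Cᵐᵒᵖ (BalancedTensor B M N) := BalancedTensor.rightModule B Cᵐᵒᵖ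
  { carrier := BalancedTensor B M N
    smulComm := ⟨fun a c t => by
      refine BalancedTensor.induction B (p := fun t => a • c • t = c • a • t) ?_ ?_ ?_ t
      · simp
      · intro x y; rfl
      · intro s t hs ht; simp only [smul_add, hs, ht]⟩
    towerLeft := ⟨fun k a t => by
      refine BalancedTensor.induction B (p := fun t => (k • a) • t = k • a • t) ?_ ?_ ?_ t
      · simp
      · intro x y
        exact congrArg (fun z => BalancedTensor.tmul B z y) (smul_assoc k a x)
      · intro s t hs ht; simp only [smul_add, hs, ht]⟩
    towerRight := ⟨fun k c t => by
      refine BalancedTensor.induction B (p := fun t => (k • c) • t = k • c • t) ?_ ?_ ?_ t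
      · simp
      · intro x y
        change BalancedTensor.tmul B x ((k • c) • y) = BalancedTensor.tmul B (k • x) (c • y)
        have h : k • x = op (algebraMap K B k) • x := by
          rw [← MulOpposite.algebraMap_apply, algebraMap_smul]
        rw [h, BalancedTensor.smul_tmul, algebraMap_smul, smul_assoc]
      · intro s t hs ht; simp only [smul_add, hs, ht]⟩ }

/-- `N ⊗_A M` as a right `B`-module, for a right `A`-module `N` and an `(A, B)`-bimodule `M`. -/
noncomputable def tensorRightObj (M : CentralBimodule K A B) (N : ModuleCat.{u} Aᵐᵒᵖ) :
    ModuleCat.{u} Bᵐᵒᵖ :=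
  letI : Module Bᵐᵒᵖ (BalancedTensor A N M) := BalancedTensor.rightModule A Bᵐᵒᵖ
  ModuleCat.of Bᵐᵒᵖ (BalancedTensor A N M)

/-- The right `B`-linear map `f ⊗_A M`. -/
noncomputable def tensorRightMap (M : CentralBimodule K A B) {N N' : ModuleCat.{u} Aᵐᵒᵖ}
    (f : N ⟶ N') : tensorRightObj M N ⟶ tensorRightObj M N' :=
  letI : Module Bᵐᵒᵖ (BalancedTensor A N M) := BalancedTensor.rightModule A Bᵐᵒᵖ
  letI : Module Bᵐᵒᵖ (BalancedTensor A N' M) := BalancedTensor.rightModule A Bᵐᵒᵖ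
  ModuleCat.ofHom
    { toFun := BalancedTensor.map A f.hom LinearMap.id
      map_add' := map_add _
      map_smul' := fun b t => by
        refine BalancedTensor.induction A (p := fun t =>
          BalancedTensor.map A f.hom LinearMap.id (b • t) =
            b • BalancedTensor.map A f.hom LinearMap.id t) ?_ ?_ ?_ t
        · simp
        · intro x y; rfl
        · intro s t hs ht; simp only [smul_add, map_add, hs, ht] }

/-- For an `(A, B)`-bimodule `M`, the functor `- ⊗_A M` from right `A`-modules to right
`B`-modules. -/
noncomputable def tensorRight (M : CentralBimodule K A B) :
    ModuleCat.{u} Aᵐᵒᵖ ⥤ ModuleCat.{u} Bᵐᵒᵖ where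
  obj N := tensorRightObj M N
  map f := tensorRightMap M f
  map_id N := by
    refine ModuleCat.hom_ext (LinearMap.ext fun t => ?_)
    exact DFunLike.congr_fun (BalancedTensor.map_id A (M := N) (N := M)) t
  map_comp f g := by
    refine ModuleCat.hom_ext (LinearMap.ext fun t => ?_)
    exact DFunLike.congr_fun (BalancedTensor.map_comp A g.hom f.hom LinearMap.id
      (LinearMap.id : M →ₗ[A] M)) t

instance (M : CentralBimodule K A B) : (tensorRight M).Additive where
  map_add {_ _ f g} := by
    refine ModuleCat.hom_ext (LinearMap.ext fun t => ?_)
    exact DFunLike.congr_fun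
      (BalancedTensor.map_add_left A f.hom g.hom (LinearMap.id : M →ₗ[A] M)) t

/-- `M ⊗_B N` as a left `A`-module, for an `(A, B)`-bimodule `M` and a left `B`-module `N`. -/
noncomputable def tensorLeftObj (M : CentralBimodule K A B) (N : ModuleCat.{u} B) :
    ModuleCat.{u} A :=
  letI : Module A (BalancedTensor B M N) := BalancedTensor.leftModule B A
  ModuleCat.of A (BalancedTensor B M N)

/-- The left `A`-linear map `M ⊗_B f`. -/
noncomputable def tensorLeftMap (M : CentralBimodule K A B) {N N' : ModuleCat.{u} B}
    (f : N ⟶ N') : tensorLeftObj M N ⟶ tensorLeftObj M N' :=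
  letI : Module A (BalancedTensor B M N) := BalancedTensor.leftModule B A
  letI : Module A (BalancedTensor B M N') := BalancedTensor.leftModule B A
  ModuleCat.ofHom
    { toFun := BalancedTensor.map B LinearMap.id f.hom
      map_add' := map_add _
      map_smul' := fun a t => by
        refine BalancedTensor.induction B (p := fun t =>
          BalancedTensor.map B LinearMap.id f.hom (a • t) =
            a • BalancedTensor.map B LinearMap.id f.hom t) ?_ ?_ ?_ t
        · simp
        · intro x y; rfl
        · intro s t hs ht; simp only [smul_add, map_add, hs, ht] }

/-- For an `(A, B)`-bimodule `M`, the functor `M ⊗_B -` from left `B`-modules to left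
`A`-modules. -/
noncomputable def tensorLeft (M : CentralBimodule K A B) :
    ModuleCat.{u} B ⥤ ModuleCat.{u} A where
  obj N := tensorLeftObj M N
  map f := tensorLeftMap M f
  map_id N := by
    refine ModuleCat.hom_ext (LinearMap.ext fun t => ?_)
    exact DFunLike.congr_fun (BalancedTensor.map_id B (M := M) (N := N)) t
  map_comp f g := by
    refine ModuleCat.hom_ext (LinearMap.ext fun t => ?_)
    exact DFunLike.congr_fun (BalancedTensor.map_comp B (LinearMap.id : M →ₗ[Bᵐᵒᵖ] M)
      LinearMap.id g.hom f.hom) t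

instance (M : CentralBimodule K A B) : (tensorLeft M).Additive where
  map_add {_ _ f g} := by
    refine ModuleCat.hom_ext (LinearMap.ext fun t => ?_)
    exact DFunLike.congr_fun
      (BalancedTensor.map_add_right B (LinearMap.id : M →ₗ[Bᵐᵒᵖ] M) f.hom g.hom) t

/-- `Tor_j^A(N, M)` for a right `A`-module `N` and an `(A, B)`-bimodule `M`, as a right
`B`-module. -/
noncomputable def torRight (M : CentralBimodule K A B) (j : ℕ) (N : ModuleCat.{u} Aᵐᵒᵖ) :
    ModuleCat.{u} Bᵐᵒᵖ :=
  ((tensorRight M).leftDerived j).obj N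

/-- `Tor_j^B(M, N)` for an `(A, B)`-bimodule `M` and a left `B`-module `N`, as a left
`A`-module. -/
noncomputable def torLeft (M : CentralBimodule K A B) (j : ℕ) (N : ModuleCat.{u} B) : ModuleCat.{u} A :=
  ((tensorLeft M).leftDerived j).obj N

end CentralBimodule

/-! ### Dimension functions -/

/-- A numerical function on left modules over `K`-algebras. Its values on right `A`-modules are
its values on modules over `Aᵐᵒᵖ`. -/
abbrev DimFunction (K : Type v) [CommRing K] : Type (max v (u + 1)) :=
  ∀ (A : Type u) [Ring A] [Algebra K A] (M : Type u) [AddCommGroup M] [Module A M], EReal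

section Dimension

variable {K : Type v} [CommRing K]

/-- `δ` is an exact dimension function on left `A`-modules, with values in `ℝ≥0 ∪ {±∞}`. -/
structure IsExactDimension (δ : DimFunction.{v, u} K) (A : Type u) [Ring A] [Algebra K A] :
    Prop where
  /-- The only value outside `[0, ∞]` is `-∞`. -/
  eq_bot_or_nonneg : ∀ (M : Type u) [AddCommGroup M] [Module A M], δ A M = ⊥ ∨ 0 ≤ δ A M
  eq_bot_iff : ∀ (M : Type u) [AddCommGroup M] [Module A M], δ A M = ⊥ ↔ Subsingleton M
  /-- `δ` depends only on the isomorphism class of a module. -/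
  congr : ∀ (M N : Type u) [AddCommGroup M] [Module A M] [AddCommGroup N] [Module A N],
    (M ≃ₗ[A] N) → δ A M = δ A N
  exact : ∀ (M : Type u) [AddCommGroup M] [Module A M] (N : Submodule A M),
    δ A M = max (δ A N) (δ A (M ⧸ N))
  /-- Compatibility with unions of directed systems of submodules. -/
  directed : ∀ (M : Type u) [AddCommGroup M] [Module A M] (S : Set (Submodule A M)),
    S.Nonempty → DirectedOn (· ≤ ·) S → δ A ↥(sSup S) = sSup ((fun N : Submodule A M => δ A N) '' S)

/-- `∂(A)`, the dimension of `A` as a right module over itself. -/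
def DimFunction.alg (δ : DimFunction.{v, u} K) (A : Type u) [Ring A] [Algebra K A] : EReal :=
  δ Aᵐᵒᵖ A

/-- For every `(A, B)`-bimodule `M`: if `M` is finitely generated over `B` then
`∂(_A M) ≤ ∂(M_B)`, and if `M` is finitely generated over `A` then `∂(M_B) ≤ ∂(_A M)`. -/
def IsSymmetricDimension (δ : DimFunction.{v, u} K) (A B : Type u) [Ring A] [Algebra K A] [Ring B]
    [Algebra K B] : Prop :=
  ∀ M : CentralBimodule K A B,
    (Module.Finite Bᵐᵒᵖ M → δ A M ≤ δ Bᵐᵒᵖ M) ∧ (Module.Finite A M → δ Bᵐᵒᵖ M ≤ δ A M)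

/-- `M` is a finitely generated left `A`-module of dimension at most `n`. -/
def IsSmallFG (δ : DimFunction.{v, u} K) (n : EReal) (A : Type u) [Ring A] [Algebra K A]
    (M : Type u) [AddCommGroup M] [Module A M] : Prop :=
  Module.Finite A M ∧ δ A M ≤ n

/-- The condition `γ_{n,i}(A, B)`: for every `(A, B)`-bimodule `M` finitely generated on both sides
and all `j ≤ i`, the functors `Tor_j^A(-, M)` and `Tor_j^B(M, -)` preserve finitely generated modules
of dimension at most `n`. -/
def GammaCondition (δ : DimFunction.{v, u} K) (n : EReal) (i : ℕ) (A B : Type u) [Ring A]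
    [Algebra K A] [Ring B] [Algebra K B] : Prop :=
  ∀ M : CentralBimodule K A B, M.IsFG →
    (∀ N : ModuleCat.{u} Aᵐᵒᵖ, IsSmallFG δ n Aᵐᵒᵖ N →
      ∀ j ≤ i, IsSmallFG δ n Bᵐᵒᵖ (M.torRight j N)) ∧
    (∀ N : ModuleCat.{u} B, IsSmallFG δ n B N →
      ∀ j ≤ i, IsSmallFG δ n A (M.torLeft j N))

/-- Two `(D, A)`-bimodules `X`, `Y` are `n`-isomorphic: there are a `(D, A)`-bimodule `P` and bimodule
morphisms `X → P ← Y` whose kernels and cokernels have dimension at most `n` as right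
`A`-modules. -/
def NIsomorphic (δ : DimFunction.{v, u} K) (n : EReal) {D A : Type u} [Ring D] [Algebra K D] [Ring A]
    [Algebra K A] (X Y : CentralBimodule K D A) : Prop :=
  ∃ (P : CentralBimodule K D A) (f : X →ₗ[Aᵐᵒᵖ] P) (g : Y →ₗ[Aᵐᵒᵖ] P),
    (∀ (d : D) (x : X), f (d • x) = d • f x) ∧ (∀ (d : D) (y : Y), g (d • y) = d • g y) ∧
    δ Aᵐᵒᵖ (LinearMap.ker f) ≤ n ∧ δ Aᵐᵒᵖ (P ⧸ LinearMap.range f) ≤ n ∧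
    δ Aᵐᵒᵖ (LinearMap.ker g) ≤ n ∧ δ Aᵐᵒᵖ (P ⧸ LinearMap.range g) ≤ n

end Dimension

/-! ### Grade, Auslander regularity and the Cohen–Macaulay property -/

section Homological

/-- `Ext_R^i(M, D)` for a left `R`-module `M` and a left `R`-module `D`. -/
abbrev ExtTo (R : Type u) [Ring R] (D : Type u) [AddCommGroup D] [Module R D]
    (M : Type u) [AddCommGroup M] [Module R M] (i : ℕ) : Type u :=
  Abelian.Ext.{u} (ModuleCat.of R M) (ModuleCat.of R D) i

/-- A ring `S` acting on `D` by `R`-linear maps acts on `Ext_R^i(M, D)` by functoriality in `D`. -/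
noncomputable instance ExtTo.module (R S : Type u) [Ring R] [Ring S] (D : Type u) [AddCommGroup D]
    [Module R D] [Module S D] [SMulCommClass S R D] (M : Type u) [AddCommGroup M] [Module R M]
    (i : ℕ) : Module S (ExtTo R D M i) where
  smul s e := e.comp (Abelian.Ext.mk₀ (ModuleCat.ofHom (Module.toModuleEnd R (S := S) D s)))
    (add_zero i)
  one_smul e := by
    change e.comp (Abelian.Ext.mk₀ (ModuleCat.ofHom (Module.toModuleEnd R (S := S) D 1))) _ = e
    rw [map_one]
    exact Abelian.Ext.comp_mk₀_id e
  mul_smul s t e := by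
    change e.comp (Abelian.Ext.mk₀ (ModuleCat.ofHom (Module.toModuleEnd R (S := S) D (s * t)))) _ =
      (e.comp (Abelian.Ext.mk₀ (ModuleCat.ofHom (Module.toModuleEnd R (S := S) D t))) _).comp
        (Abelian.Ext.mk₀ (ModuleCat.ofHom (Module.toModuleEnd R (S := S) D s))) _
    rw [Abelian.Ext.comp_assoc_of_third_deg_zero, Abelian.Ext.mk₀_comp_mk₀, map_mul]
    rfl
  smul_zero s := Abelian.Ext.zero_comp _ _ _ _ _
  smul_add s e e' := Abelian.Ext.add_comp _ _ _ _
  add_smul s t e := by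
    change e.comp (Abelian.Ext.mk₀ (ModuleCat.ofHom (Module.toModuleEnd R (S := S) D (s + t)))) _ =
      e.comp (Abelian.Ext.mk₀ (ModuleCat.ofHom (Module.toModuleEnd R (S := S) D s))) _ +
      e.comp (Abelian.Ext.mk₀ (ModuleCat.ofHom (Module.toModuleEnd R (S := S) D t))) _
    rw [← Abelian.Ext.comp_add, ← Abelian.Ext.mk₀_add, map_add]
    rfl
  zero_smul e := by
    change e.comp (Abelian.Ext.mk₀ (ModuleCat.ofHom (Module.toModuleEnd R (S := S) D 0))) _ = 0
    rw [map_zero]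
    change e.comp (Abelian.Ext.mk₀ 0) _ = 0
    rw [Abelian.Ext.mk₀_zero, Abelian.Ext.comp_zero]

/-- The least `i` with `Ext_R^i(M, D) ≠ 0`, and `∞` if there is none. For `R = A`, `D = A`
(respectively `R = Aᵐᵒᵖ`, `D = A`) it is the grade number of the left (right) `A`-module `M`. -/
noncomputable def gradeNumber (R : Type u) [Ring R] (D : Type u) [AddCommGroup D] [Module R D]
    (M : Type u) [AddCommGroup M] [Module R M] : ℕ∞ :=
  sInf {n : ℕ∞ | ∃ i : ℕ, n = i ∧ Nontrivial (ExtTo R D M i)}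

/-- The Auslander condition for all finitely generated `R`-modules `M`: for all `q`, every
`S`-submodule of `Ext_R^q(M, D)` has grade at least `q`. For `D = A` and `(R, S) = (Aᵐᵒᵖ, A)` (or
`(A, Aᵐᵒᵖ)`) it is the condition for the right (left) `A`-modules. -/
def AuslanderCondition (R S : Type u) [Ring R] [Ring S] (D : Type u) [AddCommGroup D]
    [Module R D] [Module S D] [SMulCommClass S R D] : Prop :=
  ∀ (M : Type u) [AddCommGroup M] [Module R M], Module.Finite R M →
    ∀ (q : ℕ) (N : Submodule S (ExtTo R D M q)), (q : ℕ∞) ≤ gradeNumber S D N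

/-- The global dimension of `A`, computed with right modules. -/
noncomputable def globalDim (A : Type u) [Ring A] : WithBot ℕ∞ :=
  ⨆ M : ModuleCat.{u} Aᵐᵒᵖ, projectiveDimension M

/-- Auslander regular: finite global dimension, and the Auslander condition holds for all finitely
generated left and right modules. -/
def IsAuslanderRegular (A : Type u) [Ring A] : Prop :=
  (∃ n : ℕ, globalDim A = n) ∧ AuslanderCondition Aᵐᵒᵖ A A ∧ AuslanderCondition A Aᵐᵒᵖ A

/-- `∂`-Cohen–Macaulay: `∂(A) ∈ ℕ`, and `j(M) + ∂(M) = ∂(A)` for all nonzero finitely generated right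
modules and all nonzero finitely generated left modules `M`. -/
def IsDimCM {K : Type v} [CommRing K] (δ : DimFunction.{v, u} K) (A : Type u) [Ring A]
    [Algebra K A] : Prop :=
  (∃ d : ℕ, δ.alg A = d) ∧
  (∀ (M : Type u) [AddCommGroup M] [Module Aᵐᵒᵖ M], Module.Finite Aᵐᵒᵖ M → Nontrivial M →
    ((gradeNumber Aᵐᵒᵖ A M : ENNReal) : EReal) + δ Aᵐᵒᵖ M = δ.alg A) ∧
  (∀ (M : Type u) [AddCommGroup M] [Module A M], Module.Finite A M → Nontrivial M →
    ((gradeNumber A A M : ENNReal) : EReal) + δ A M = δ.alg A)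

end Homological

/-! ### The ambient class of algebras and noncommutative quasi-resolutions -/

/-- A class of (left and right) noetherian `K`-algebras which contains `A` if and only if it contains
the opposite algebra of `A`. -/
structure AlgebraClass (K : Type v) [CommRing K] where
  /-- Membership in the class. -/
  Mem : ∀ (A : Type u) [Ring A] [Algebra K A], Prop
  noetherian_left : ∀ (A : Type u) [Ring A] [Algebra K A], Mem A → IsNoetherianRing A
  noetherian_right : ∀ (A : Type u) [Ring A] [Algebra K A], Mem A → IsNoetherianRing Aᵐᵒᵖ
  mem_op_iff : ∀ (A : Type u) [Ring A] [Algebra K A], Mem Aᵐᵒᵖ ↔ Mem A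

section Main

variable {K : Type v} [CommRing K]

/-- The standing hypothesis on the class `𝒜` and the dimension function `δ`. -/
structure StandingHypothesis (𝒜 : AlgebraClass.{v, u} K) (δ : DimFunction.{v, u} K) : Prop where
  exact_left : ∀ (A : Type u) [Ring A] [Algebra K A], 𝒜.Mem A → IsExactDimension δ A
  exact_right : ∀ (A : Type u) [Ring A] [Algebra K A], 𝒜.Mem A → IsExactDimension δ Aᵐᵒᵖ
  dim_nat : ∀ (A : Type u) [Ring A] [Algebra K A], 𝒜.Mem A → ∃ d : ℕ, δ.alg A = d
  symmetric : ∀ (A B : Type u) [Ring A] [Algebra K A] [Ring B] [Algebra K B],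
    𝒜.Mem A → 𝒜.Mem B → IsSymmetricDimension δ A B
  gamma : ∀ (A B : Type u) [Ring A] [Algebra K A] [Ring B] [Algebra K B],
    𝒜.Mem A → 𝒜.Mem B → δ.alg A = δ.alg B → GammaCondition δ (δ.alg A - 2) 1 A B

/-- `(B, M, N)` is a noncommutative quasi-resolution of `A`: with `d = ∂(A)`, `B` is an Auslander
regular `∂`-Cohen–Macaulay algebra in the class with `∂(B) = d`, and the `(B, A)`-bimodule `M` and the
`(A, B)`-bimodule `N` are finitely generated on both sides and satisfy `M ⊗_A N ≅_{d-2} B` and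
`N ⊗_B M ≅_{d-2} A` as bimodules. -/
structure IsNQR (𝒜 : AlgebraClass.{v, u} K) (δ : DimFunction.{v, u} K) (A : Type u) [Ring A]
    [Algebra K A] (B : Type u) [Ring B] [Algebra K B] (M : CentralBimodule K B A)
    (N : CentralBimodule K A B) : Prop where
  mem : 𝒜.Mem B
  auslanderRegular : IsAuslanderRegular B
  cohenMacaulay : IsDimCM δ B
  dim_eq : δ.alg B = δ.alg A
  fg_left : M.IsFG
  fg_right : N.IsFG
  iso_left : NIsomorphic δ (δ.alg A - 2) (M.tensor N) (CentralBimodule.regular K B)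
  iso_right : NIsomorphic δ (δ.alg A - 2) (N.tensor M) (CentralBimodule.regular K A)

end Main

/-! Put d = ∂(A). Call a module small if its dimension is at most d - 2, and a map an almost
isomorphism if its kernel and cokernel are small. Modulo small modules, M = M₁ ⊗_A N₂ and N = M₂ ⊗_A
N₁ are inverse bimodules between B₁ and B₂ (`exists_pairing`). The point is to replace them by
bimodules that are inverse on the nose.

Two facts do this. First, let B be Cohen–Macaulay with ∂(B) = d. A small finitely generated right
module has grade at least 2, so it has no Hom and no Ext¹ into B. Hence maps into B, or into a
finitely generated projective, extend uniquely along almost isomorphisms of finitely generated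
modules: such targets are closed (`IsClosedModule`). An almost isomorphism between finitely
generated closed modules is bijective.

Second, a nonzero submodule of Ext^q(X, B) has grade at least q by the Auslander condition and at
most d by the Cohen–Macaulay equation, if it is finitely generated; so Ext^q(X, B) = 0 for q > d. As
d ≤ 2 and the global dimension is finite, finitely generated right modules have projective dimension
at most 2. The dual of a finitely generated left module is a second syzygy, hence projective
(`IsDimCM.projective_dual`). In particular double duals are projective.

Let P and Q be the double duals of M over B₂ and of N over B₁. The evaluation map M → P is an almost
isomorphism: its kernel is small because M has an almost inverse (`ker_doubleDualEval_le`), its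
cokernel because the Auslander condition gives it grade at least 2
(`IsDimCM.doubleDualEval_coker_le`). The same holds for N → Q. Then M ⊗ N → P ⊗ Q is an almost
isomorphism, and M ⊗ N → B₁ extends to an almost isomorphism P ⊗ Q → B₁ between closed modules,
which is therefore bijective. By symmetry Q ⊗ P ≅ B₂, so tensoring with P and Q gives the
equivalence.

All this needs tensor products to preserve almost isomorphisms. On the left this follows from a free
presentation (`IsAlmostIso.mapRight`); on the right it is what the condition γ on Tor₀ and Tor₁
provides (`IsAlmostIso.rTensor`). -/

/-! ### Small modules and almost isomorphisms. -/

section DimensionLemmas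

variable {K : Type v} [CommRing K] {δ : DimFunction.{v, u} K} {n : EReal} {R : Type u} [Ring R]
  [Algebra K R] {X Y Z W : Type u} [AddCommGroup X] [Module R X] [AddCommGroup Y] [Module R Y]
  [AddCommGroup Z] [Module R Z] [AddCommGroup W] [Module R W]

namespace IsExactDimension

theorem le_of_injective (hδ : IsExactDimension δ R) {f : X →ₗ[R] Y} (hf : Function.Injective f)
    (h : δ R Y ≤ n) : δ R X ≤ n := by
  rw [hδ.congr _ _ (LinearEquiv.ofInjective f hf)]
  rw [hδ.exact Y (LinearMap.range f)] at h
  exact (le_max_left _ _).trans h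

theorem le_of_surjective (hδ : IsExactDimension δ R) {f : X →ₗ[R] Y} (hf : Function.Surjective f)
    (h : δ R X ≤ n) : δ R Y ≤ n := by
  rw [← hδ.congr _ _ (f.quotKerEquivOfSurjective hf)]
  rw [hδ.exact X (LinearMap.ker f)] at h
  exact (le_max_right _ _).trans h

theorem le_of_subsingleton (hδ : IsExactDimension δ R) [Subsingleton X] : δ R X ≤ n := by
  rw [(hδ.eq_bot_iff X).2 inferInstance]
  exact bot_le

theorem le_of_submodule (hδ : IsExactDimension δ R) (S : Submodule R X) (h : δ R S ≤ n)
    (h' : δ R (X ⧸ S) ≤ n) : δ R X ≤ n := by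
  rw [hδ.exact X S]
  exact max_le h h'

theorem submodule_mono (hδ : IsExactDimension δ R) {S T : Submodule R X} (hST : S ≤ T)
    (h : δ R T ≤ n) : δ R S ≤ n :=
  hδ.le_of_injective (Submodule.inclusion_injective hST) h

theorem map_le (hδ : IsExactDimension δ R) (f : X →ₗ[R] Y) {S : Submodule R X}
    (h : δ R S ≤ n) : δ R (S.map f) ≤ n :=
  hδ.le_of_surjective (f := (f.restrict (p := S) (q := S.map f)
    fun _ hx => Submodule.mem_map_of_mem hx)) (by
      rintro ⟨_, x, hx, rfl⟩
      exact ⟨⟨x, hx⟩, rfl⟩) h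

/-- Half of exactness suffices: `ker g` is bounded by the image of `f`, and `Y / ker g` embeds in
`Z`. The composite `g ∘ f` need not vanish. -/
theorem le_of_ker_le_range (hδ : IsExactDimension δ R) (f : X →ₗ[R] Y) (g : Y →ₗ[R] Z)
    (hfg : LinearMap.ker g ≤ LinearMap.range f) (hX : δ R X ≤ n) (hZ : δ R Z ≤ n) :
    δ R Y ≤ n := by
  refine hδ.le_of_submodule (LinearMap.ker g) (hδ.submodule_mono hfg ?_) ?_
  · exact hδ.le_of_surjective f.surjective_rangeRestrict hX
  · exact hδ.le_of_injective (f := (LinearMap.ker g).liftQ g le_rfl)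
      (LinearMap.ker_eq_bot.1 (Submodule.ker_liftQ_eq_bot _ _ _ le_rfl)) hZ

/-- If `q : G → E` is surjective, then `E` is small as soon as the image under `q` of the kernel of
a map from `G` to a small module is small. -/
theorem le_of_surjective_of_map_ker (hδ : IsExactDimension δ R) (q : X →ₗ[R] Y) (p : X →ₗ[R] Z)
    (hq : Function.Surjective q) (h : δ R ((LinearMap.ker p).map q) ≤ n) (hZ : δ R Z ≤ n) :
    δ R Y ≤ n := by
  refine hδ.le_of_submodule _ h ?_
  have hX : δ R (X ⧸ LinearMap.ker p) ≤ n :=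
    hδ.le_of_injective (f := (LinearMap.ker p).liftQ p le_rfl)
      (LinearMap.ker_eq_bot.1 (Submodule.ker_liftQ_eq_bot _ _ _ le_rfl)) hZ
  refine hδ.le_of_surjective (f := Submodule.mapQ (LinearMap.ker p) ((LinearMap.ker p).map q) q
    (Submodule.le_comap_map _ _)) ?_ hX
  intro y
  obtain ⟨y, rfl⟩ := Submodule.Quotient.mk_surjective _ y
  obtain ⟨x, rfl⟩ := hq y
  exact ⟨Submodule.Quotient.mk x, rfl⟩

theorem sup_le (hδ : IsExactDimension δ R) {S T : Submodule R X} (hS : δ R S ≤ n)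
    (hT : δ R T ≤ n) : δ R ↥(S ⊔ T) ≤ n := by
  refine hδ.le_of_ker_le_range (Submodule.inclusion (le_sup_left : S ≤ S ⊔ T))
    (Submodule.mkQ (LinearMap.range (Submodule.inclusion (le_sup_left : S ≤ S ⊔ T))))
    (by rw [Submodule.ker_mkQ]) hS ?_
  refine hδ.le_of_surjective (f := (Submodule.mkQ _) ∘ₗ
    (Submodule.inclusion (le_sup_right : T ≤ S ⊔ T))) ?_ hT
  intro y
  obtain ⟨⟨y, hy⟩, rfl⟩ := Submodule.Quotient.mk_surjective _ y
  obtain ⟨s, hs, t, ht, rfl⟩ := Submodule.mem_sup.1 hy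
  refine ⟨⟨t, ht⟩, ?_⟩
  refine (Submodule.Quotient.eq _).2 ⟨⟨-s, S.neg_mem hs⟩, ?_⟩
  ext
  simp

theorem iSup_le {ι : Type*} [Finite ι] (hδ : IsExactDimension δ R) {S : ι → Submodule R X}
    (hS : ∀ i, δ R (S i) ≤ n) : δ R ↥(⨆ i, S i) ≤ n := by
  classical
  have := Fintype.ofFinite ι
  rw [← Finset.sup_univ_eq_iSup]
  induction (Finset.univ : Finset ι) using Finset.induction_on with
  | empty => rw [Finset.sup_empty]; exact hδ.le_of_subsingleton
  | insert i s _ ih => rw [Finset.sup_insert]; exact hδ.sup_le (hS i) ih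

/-- A module which is the sum of finitely many homomorphic images of a small module is small. -/
theorem le_of_sum_surjective {ι : Type*} [Fintype ι] (hδ : IsExactDimension δ R)
    (g : ι → X →ₗ[R] Y) (hg : ∀ y, ∃ x : ι → X, y = ∑ i, g i (x i)) (hX : δ R X ≤ n) :
    δ R Y ≤ n := by
  have h := hδ.iSup_le (S := fun i => LinearMap.range (g i))
    fun i => hδ.le_of_surjective (g i).surjective_rangeRestrict hX
  refine hδ.le_of_surjective (f := (⨆ i, LinearMap.range (g i)).subtype) ?_ h
  intro y
  obtain ⟨x, rfl⟩ := hg y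
  exact ⟨⟨_, Submodule.sum_mem _ fun i _ => Submodule.mem_iSup_of_mem i ⟨x i, rfl⟩⟩, rfl⟩

theorem pi_le {ι : Type} [Fintype ι] (hδ : IsExactDimension δ R) (hX : δ R X ≤ n) :
    δ R (ι → X) ≤ n := by
  classical
  refine hδ.le_of_sum_surjective (fun i => LinearMap.single R (fun _ => X) i) (fun y => ⟨y, ?_⟩) hX
  exact (Finset.univ_sum_single y).symm

end IsExactDimension

/-- A linear map whose kernel and cokernel have dimension at most `n`. -/
structure IsAlmostIso (δ : DimFunction.{v, u} K) (n : EReal) (f : X →ₗ[R] Y) : Prop where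
  ker_le : δ R (LinearMap.ker f) ≤ n
  coker_le : δ R (Y ⧸ LinearMap.range f) ≤ n

namespace IsAlmostIso

theorem of_bijective (hδ : IsExactDimension δ R) {f : X →ₗ[R] Y} (hf : Function.Bijective f) :
    IsAlmostIso δ n f := by
  constructor
  · rw [LinearMap.ker_eq_bot.2 hf.1]
    exact hδ.le_of_subsingleton
  · rw [LinearMap.range_eq_top.2 hf.2]
    exact hδ.le_of_subsingleton

theorem comp (hδ : IsExactDimension δ R) {f : X →ₗ[R] Y} {g : Y →ₗ[R] Z}
    (hg : IsAlmostIso δ n g) (hf : IsAlmostIso δ n f) : IsAlmostIso δ n (g ∘ₗ f) := by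
  constructor
  · refine hδ.le_of_ker_le_range (Submodule.inclusion (LinearMap.ker_le_ker_comp f g))
      (f.restrict (p := LinearMap.ker (g ∘ₗ f)) (q := LinearMap.ker g) fun _ hx => hx) ?_
      hf.ker_le hg.ker_le
    rintro ⟨x, hx⟩ hx'
    exact ⟨⟨x, congrArg Subtype.val hx'⟩, rfl⟩
  · refine hδ.le_of_ker_le_range (Submodule.mapQ (LinearMap.range f) (LinearMap.range (g ∘ₗ f)) g ?_)
      (Submodule.mapQ (LinearMap.range (g ∘ₗ f)) (LinearMap.range g) LinearMap.id ?_) ?_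
      hf.coker_le hg.coker_le
    · rintro _ ⟨x, rfl⟩
      exact ⟨x, rfl⟩
    · exact LinearMap.range_comp_le_range f g
    · intro z hz
      obtain ⟨z, rfl⟩ := Submodule.Quotient.mk_surjective _ z
      obtain ⟨y, rfl⟩ := (Submodule.Quotient.mk_eq_zero _).1 hz
      exact ⟨Submodule.Quotient.mk y, rfl⟩

/-- Cancellation on the right: `ker g` sits between `ker (g ∘ f)` and the cokernel of `f`. It shows
that an extension of an almost isomorphism along an almost isomorphism is again one. -/
theorem of_comp (hδ : IsExactDimension δ R) {f : X →ₗ[R] Y} {g : Y →ₗ[R] Z}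
    (hf : IsAlmostIso δ n f) (hgf : IsAlmostIso δ n (g ∘ₗ f)) : IsAlmostIso δ n g := by
  constructor
  · refine hδ.le_of_ker_le_range
      (f.restrict (p := LinearMap.ker (g ∘ₗ f)) (q := LinearMap.ker g) fun _ hx => hx)
      ((LinearMap.range f).mkQ ∘ₗ (LinearMap.ker g).subtype) ?_ hgf.ker_le hf.coker_le
    rintro ⟨y, hy⟩ hy'
    obtain ⟨x, rfl⟩ := (Submodule.Quotient.mk_eq_zero _).1 hy'
    exact ⟨⟨x, hy⟩, rfl⟩
  · refine hδ.le_of_surjective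
      (f := Submodule.factor (LinearMap.range_comp_le_range f g)) ?_ hgf.coker_le
    exact Submodule.factor_surjective _

/-- The four lemma modulo small modules. A class in `ker γ` is lifted to a pair in the fibre product
of `F₁` and `K₂` over `F₂`; if its second coordinate comes from `K₁`, subtracting that element moves
the first coordinate into `ker β`. -/
theorem four_lemma (hδ : IsExactDimension δ R) {K₁ F₁ X₁ K₂ F₂ X₂ : Type u}
    [AddCommGroup K₁] [Module R K₁] [AddCommGroup F₁] [Module R F₁] [AddCommGroup X₁] [Module R X₁]
    [AddCommGroup K₂] [Module R K₂] [AddCommGroup F₂] [Module R F₂] [AddCommGroup X₂] [Module R X₂]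
    {u₁ : K₁ →ₗ[R] F₁} {v₁ : F₁ →ₗ[R] X₁} {u₂ : K₂ →ₗ[R] F₂} {v₂ : F₂ →ₗ[R] X₂}
    {α : K₁ →ₗ[R] K₂} {β : F₁ →ₗ[R] F₂} {γ : X₁ →ₗ[R] X₂} (hv₁ : Function.Surjective v₁)
    (h₁ : v₁ ∘ₗ u₁ = 0) (h₂ : LinearMap.ker v₂ ≤ LinearMap.range u₂)
    (hαβ : β ∘ₗ u₁ = u₂ ∘ₗ α) (hβγ : γ ∘ₗ v₁ = v₂ ∘ₗ β)
    (hα : δ R (K₂ ⧸ LinearMap.range α) ≤ n) (hβ : δ R (LinearMap.ker β) ≤ n) :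
    δ R (LinearMap.ker γ) ≤ n := by
  let G : Submodule R (F₁ × K₂) :=
    LinearMap.ker (β ∘ₗ LinearMap.fst R F₁ K₂ - u₂ ∘ₗ LinearMap.snd R F₁ K₂)
  have hG : ∀ x : F₁ × K₂, x ∈ G ↔ β x.1 = u₂ x.2 := fun x => by
    simp [G, LinearMap.mem_ker, sub_eq_zero]
  have hu₂ : ∀ k, v₂ (u₂ (α k)) = 0 := fun k => by
    have e₁ := LinearMap.congr_fun hαβ k
    have e₂ := LinearMap.congr_fun hβγ (u₁ k)
    have e₃ := LinearMap.congr_fun h₁ k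
    simp only [LinearMap.comp_apply, LinearMap.zero_apply] at e₁ e₂ e₃
    rw [← e₁, ← e₂, e₃, map_zero]
  -- `v₂ ∘ u₂` is not assumed to be zero, so its vanishing on the second coordinate is imposed.
  let G' : Submodule R (F₁ × K₂) := G ⊓ LinearMap.ker (v₂ ∘ₗ u₂ ∘ₗ LinearMap.snd R F₁ K₂)
  have hG'γ : ∀ x : G', γ (v₁ x.1.1) = 0 := fun x => by
    have e := LinearMap.congr_fun hβγ x.1.1
    simp only [LinearMap.comp_apply] at e
    rw [e, (hG _).1 x.2.1]
    exact x.2.2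
  let q : G' →ₗ[R] LinearMap.ker γ :=
    (v₁ ∘ₗ LinearMap.fst R F₁ K₂ ∘ₗ G'.subtype).codRestrict _ hG'γ
  let p : G' →ₗ[R] K₂ ⧸ LinearMap.range α :=
    (LinearMap.range α).mkQ ∘ₗ LinearMap.snd R F₁ K₂ ∘ₗ G'.subtype
  refine hδ.le_of_surjective_of_map_ker q p ?_ ?_ hα
  · rintro ⟨x, hx⟩
    obtain ⟨f, rfl⟩ := hv₁ x
    have e := LinearMap.congr_fun hβγ f
    simp only [LinearMap.comp_apply] at e
    have hx' : v₂ (β f) = 0 := e ▸ hx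
    obtain ⟨k, hk⟩ := h₂ hx'
    refine ⟨⟨(f, k), (hG _).2 hk.symm, ?_⟩, rfl⟩
    change v₂ (u₂ k) = 0
    rw [hk, hx']
  · have hv : ∀ f ∈ LinearMap.ker β, v₁ f ∈ LinearMap.ker γ := fun f hf => by
      have e := LinearMap.congr_fun hβγ f
      simp only [LinearMap.comp_apply] at e
      rw [LinearMap.mem_ker, e, LinearMap.mem_ker.1 hf, map_zero]
    refine hδ.submodule_mono (T := LinearMap.range (v₁.restrict hv)) ?_
      (hδ.le_of_surjective (v₁.restrict hv).surjective_rangeRestrict hβ)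
    rintro _ ⟨⟨⟨f, k⟩, hfk⟩, hk, rfl⟩
    obtain ⟨k', rfl⟩ := (Submodule.Quotient.mk_eq_zero _).1 hk
    have e₁ := LinearMap.congr_fun hαβ k'
    have e₂ := LinearMap.congr_fun h₁ k'
    simp only [LinearMap.comp_apply, LinearMap.zero_apply] at e₁ e₂
    refine ⟨⟨f - u₁ k', ?_⟩, ?_⟩
    · rw [LinearMap.mem_ker, map_sub, e₁, (hG _).1 hfk.1, sub_self]
    · ext
      change v₁ (f - u₁ k') = v₁ f
      rw [map_sub, e₂, sub_zero]

end IsAlmostIso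

end DimensionLemmas

/-! ### The balanced tensor product: universal property, right exactness, associativity, units. -/

namespace BalancedTensor

attribute [local instance] leftModule rightModule

section Lift

variable {A : Type u} [Ring A] {M M' M'' N N' N'' : Type u}
  [AddCommGroup M] [Module Aᵐᵒᵖ M] [AddCommGroup M'] [Module Aᵐᵒᵖ M']
  [AddCommGroup M''] [Module Aᵐᵒᵖ M''] [AddCommGroup N] [Module A N] [AddCommGroup N'] [Module A N']
  [AddCommGroup N''] [Module A N'']

/-- The additive map out of `M ⊗_A N` induced by a balanced biadditive map. -/
noncomputable def lift {G : Type*} [AddCommGroup G] (β : M →+ N →+ G)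
    (hβ : ∀ x (a : A) y, β (op a • x) y = β x (a • y)) : BalancedTensor A M N →+ G :=
  QuotientAddGroup.lift _ (TensorProduct.liftAddHom β fun r x y => by
    rw [map_zsmul, map_zsmul]; rfl) (by
      refine (AddSubgroup.closure_le _).2 ?_
      rintro _ ⟨x, a, y, rfl⟩
      simp [hβ])

@[simp]
theorem lift_tmul {G : Type*} [AddCommGroup G] (β : M →+ N →+ G)
    (hβ : ∀ x (a : A) y, β (op a • x) y = β x (a • y)) (x : M) (y : N) :
    lift β hβ (tmul A x y) = β x y := rfl

/-- `x ⊗ -` as an additive map, additive in `x`. -/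
noncomputable def mkHom (A : Type u) [Ring A] (M N : Type u) [AddCommGroup M] [Module Aᵐᵒᵖ M]
    [AddCommGroup N] [Module A N] : M →+ N →+ BalancedTensor A M N :=
  AddMonoidHom.mk' (fun x => AddMonoidHom.mk' (fun y => tmul A x y) (tmul_add A x)) fun x x' => by
    ext y
    exact add_tmul A x x' y

@[simp]
theorem mkHom_apply (x : M) (y : N) : mkHom A M N x y = tmul A x y := rfl

section RightAction

variable {S : Type*} [Ring S] [Module S N] [SMulCommClass S A N] [Module S N'] [SMulCommClass S A N']

/-- `x ⊗ -` as an `S`-linear map. -/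
noncomputable def mkRight (S : Type*) [Ring S] [Module S N] [SMulCommClass S A N] (x : M) :
    N →ₗ[S] BalancedTensor A M N where
  toFun y := tmul A x y
  map_add' := tmul_add A x
  map_smul' _ _ := rfl

/-- An additive map out of `M ⊗_A N` which is `S`-linear on pure tensors. -/
@[simps]
noncomputable def linearOfRight {G : Type*} [AddCommGroup G] [Module S G]
    (φ : BalancedTensor A M N →+ G)
    (hφ : ∀ (s : S) x y, φ (tmul A x (s • y)) = s • φ (tmul A x y)) :
    BalancedTensor A M N →ₗ[S] G where
  toFun := φ
  map_add' := map_add φ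
  map_smul' s t := by
    refine induction A (p := fun t => φ (s • t) = s • φ t) ?_ (hφ s) ?_ t
    · simp
    · intro t t' h h'
      rw [smul_add, map_add, map_add, h, h', smul_add]

/-- `f ⊗ g` as an `S`-linear map, for `g` linear over both `A` and `S`. -/
noncomputable def mapRight (f : M →ₗ[Aᵐᵒᵖ] M') (g : N →ₗ[S] N')
    (hg : ∀ (a : A) y, g (a • y) = a • g y) : BalancedTensor A M N →ₗ[S] BalancedTensor A M' N' :=
  linearOfRight (map A f { g with map_smul' := hg }) fun s x y => by
    change tmul A (f x) (g (s • y)) = tmul A (f x) (s • g y)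
    rw [map_smul]

@[simp]
theorem mapRight_tmul (f : M →ₗ[Aᵐᵒᵖ] M') (g : N →ₗ[S] N')
    (hg : ∀ (a : A) y, g (a • y) = a • g y) (x : M) (y : N) :
    mapRight f g hg (tmul A x y) = tmul A (f x) (g y) := rfl

theorem linearMap_ext {G : Type*} [AddCommGroup G] [Module S G]
    {φ ψ : BalancedTensor A M N →ₗ[S] G} (h : ∀ x y, φ (tmul A x y) = ψ (tmul A x y)) : φ = ψ := by
  ext t
  exact DFunLike.congr_fun (hom_ext A (φ := φ.toAddMonoidHom) (ψ := ψ.toAddMonoidHom) h) t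

/-- The `S`-linear map `f ⊗_A N`. -/
noncomputable abbrev rTensor (S : Type*) [Ring S] (N : Type u) [AddCommGroup N] [Module A N]
    [Module S N] [SMulCommClass S A N] (f : M →ₗ[Aᵐᵒᵖ] M') :
    BalancedTensor A M N →ₗ[S] BalancedTensor A M' N :=
  mapRight f LinearMap.id fun _ _ => rfl

theorem rTensor_comp (f : M →ₗ[Aᵐᵒᵖ] M') (f' : M' →ₗ[Aᵐᵒᵖ] M'') :
    rTensor S N (f' ∘ₗ f) = rTensor S N f' ∘ₗ rTensor S N f :=
  linearMap_ext fun _ _ => rfl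

instance smulCommClass_left_right {S T : Type*} [Ring S] [Ring T] [Module S M]
    [SMulCommClass S Aᵐᵒᵖ M] [Module T N] [SMulCommClass T A N] :
    SMulCommClass S T (BalancedTensor A M N) where
  smul_comm s t z := by
    refine induction A (p := fun z => s • t • z = t • s • z) ?_ (fun _ _ => rfl) ?_ z
    · simp
    · intro z z' h h'
      simp only [smul_add, h, h']

instance smulCommClass_right_left {S T : Type*} [Ring S] [Ring T] [Module S M]
    [SMulCommClass S Aᵐᵒᵖ M] [Module T N] [SMulCommClass T A N] :
    SMulCommClass T S (BalancedTensor A M N) :=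
  SMulCommClass.symm _ _ _

theorem finite_right [Module.Finite Aᵐᵒᵖ M] [Module.Finite S N] :
    Module.Finite S (BalancedTensor A M N) := by
  classical
  obtain ⟨s, hs⟩ := Module.Finite.fg_top (R := Aᵐᵒᵖ) (M := M)
  have : Module.Finite S ((i : s) → N) := inferInstance
  refine Module.Finite.of_surjective
    (LinearMap.lsum S (fun _ : s => N) ℕ fun x => mkRight (A := A) S (x : M)) ?_
  rw [← LinearMap.range_eq_top, LinearMap.range_eq_top]
  intro t
  suffices h : t ∈ LinearMap.range
      (LinearMap.lsum S (fun _ : s => N) ℕ fun x => mkRight (A := A) S (x : M)) from h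
  refine induction A (p := fun t => t ∈ LinearMap.range
      (LinearMap.lsum S (fun _ : s => N) ℕ fun x => mkRight (A := A) S (x : M)))
    (Submodule.zero_mem _) ?_ (fun _ _ => Submodule.add_mem _) t
  intro x y
  have hx : x ∈ Submodule.span Aᵐᵒᵖ (s : Set M) := hs ▸ Submodule.mem_top
  induction hx using Submodule.span_induction generalizing y with
  | mem x hx =>
    refine ⟨Pi.single ⟨x, hx⟩ y, ?_⟩
    rw [LinearMap.lsum_piSingle]
    rfl
  | zero => rw [zero_tmul]; exact Submodule.zero_mem _
  | add x x' _ _ h h' => rw [add_tmul]; exact Submodule.add_mem _ (h y) (h' y)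
  | smul a x _ h => rw [← op_unop a, smul_tmul]; exact h _

end RightAction

section Exactness

theorem map_surjective {f : M →ₗ[Aᵐᵒᵖ] M'} {g : N →ₗ[A] N'} (hf : Function.Surjective f)
    (hg : Function.Surjective g) : Function.Surjective (map A f g) := by
  intro t
  refine induction A (p := fun t => ∃ s, map A f g s = t) ⟨0, map_zero _⟩ ?_ ?_ t
  · intro x y
    obtain ⟨x, rfl⟩ := hf x
    obtain ⟨y, rfl⟩ := hg y
    exact ⟨tmul A x y, rfl⟩
  · rintro _ _ ⟨s, rfl⟩ ⟨s', rfl⟩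
    exact ⟨s + s', map_add _ _ _⟩

/-- Every generating relation lifts along surjections. This reduces right exactness over `A` to
right exactness over `ℤ`. -/
theorem balancedRelations_le_map {f : M →ₗ[Aᵐᵒᵖ] M'} {g : N →ₗ[A] N'} (hf : Function.Surjective f)
    (hg : Function.Surjective g) : balancedRelations A M' N' ≤ (balancedRelations A M N).map
      (TensorProduct.map f.toAddMonoidHom.toIntLinearMap
        g.toAddMonoidHom.toIntLinearMap).toAddMonoidHom := by
  refine (AddSubgroup.closure_le _).2 ?_
  rintro _ ⟨x, a, y, rfl⟩
  obtain ⟨x, rfl⟩ := hf x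
  obtain ⟨y, rfl⟩ := hg y
  refine ⟨_, AddSubgroup.subset_closure ⟨x, a, y, rfl⟩, ?_⟩
  simp

theorem exists_of_map_left_eq_zero {f : M →ₗ[Aᵐᵒᵖ] M'} {f' : M' →ₗ[Aᵐᵒᵖ] M''}
    (h : Function.Exact f f') (hf' : Function.Surjective f') (t : BalancedTensor A M' N)
    (ht : map A f' (LinearMap.id : N →ₗ[A] N) t = 0) :
    ∃ s, map A f (LinearMap.id : N →ₗ[A] N) s = t := by
  obtain ⟨t, rfl⟩ := QuotientAddGroup.mk'_surjective _ t
  -- The image of `t` over `ℤ` is only a sum of balancing relations; subtracting a lift `r` of that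
  -- sum makes it zero, so that exactness over `ℤ` applies.
  obtain ⟨r, hr, hrt⟩ := balancedRelations_le_map hf' (Function.surjective_id (α := N))
    (g := LinearMap.id) ((QuotientAddGroup.eq_zero_iff _).1 ht)
  obtain ⟨s, hs⟩ := (rTensor_exact N (f := f.toAddMonoidHom.toIntLinearMap)
    (g := f'.toAddMonoidHom.toIntLinearMap) h hf' (t - r)).1 (by
      rw [map_sub, sub_eq_zero]
      exact hrt.symm)
  refine ⟨QuotientAddGroup.mk' _ s, ?_⟩
  refine (congrArg (QuotientAddGroup.mk' (balancedRelations A M' N)) hs).trans ?_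
  rw [map_sub, show QuotientAddGroup.mk' (balancedRelations A M' N) r = 0 from
    (QuotientAddGroup.eq_zero_iff r).2 hr, sub_zero]

end Exactness

section Free

variable {S : Type*} [Ring S] [Module S N] [SMulCommClass S A N]

/-- The coordinates of an element of `A ^ k ⊗_A N`. -/
noncomputable def piCoord (A : Type u) [Ring A] (S : Type*) [Ring S] (N : Type u) [AddCommGroup N]
    [Module A N] [Module S N] [SMulCommClass S A N] (ι : Type) [Fintype ι] :
    BalancedTensor A (ι → Aᵐᵒᵖ) N →ₗ[S] (ι → N) :=
  linearOfRight (lift (AddMonoidHom.mk' (fun x => AddMonoidHom.mk'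
    (fun y i => unop (x i) • y) fun y y' => by ext i; simp)
      fun x x' => by ext y i; simp [add_smul])
      fun x a y => by ext i; simp [mul_smul])
    fun s x y => by
      ext i
      exact (smul_comm s (unop (x i)) y).symm

theorem piCoord_tmul (ι : Type) [Fintype ι] (x : ι → Aᵐᵒᵖ) (y : N) (i : ι) :
    piCoord A S N ι (tmul A x y) i = unop (x i) • y := rfl

theorem piCoord_injective (ι : Type) [Fintype ι] : Function.Injective (piCoord A S N ι) := by
  classical
  refine Function.LeftInverse.injective
    (g := fun y => ∑ i, tmul A (Pi.single i (1 : Aᵐᵒᵖ) : ι → Aᵐᵒᵖ) (y i)) fun t => ?_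
  refine induction A (p := fun t => ∑ i, tmul A (Pi.single i (1 : Aᵐᵒᵖ) : ι → Aᵐᵒᵖ)
    (piCoord A S N ι t i) = t) ?_ ?_ ?_ t
  · simp [tmul_zero]
  · intro x y
    simp only [piCoord_tmul, ← smul_tmul]
    change ∑ i, (mkHom A _ N).flip y _ = (mkHom A _ N).flip y x
    rw [← map_sum]
    congr 1
    ext i
    simp [Finset.sum_apply, Pi.single_apply]
  · intro t t' h h'
    simp only [map_add, Pi.add_apply, tmul_add, Finset.sum_add_distrib, h, h']

end Free

end Lift

section Assoc

variable {A B M N L : Type u} [Ring A] [Ring B] [AddCommGroup M] [Module Aᵐᵒᵖ M]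
  [AddCommGroup N] [Module A N] [AddCommGroup L] [Module B L] [Module Bᵐᵒᵖ N]

theorem induction₃ [SMulCommClass Bᵐᵒᵖ A N] {p : BalancedTensor B (BalancedTensor A M N) L → Prop}
    (zero : p 0) (tmul : ∀ m n l, p (tmul B (tmul A m n) l))
    (add : ∀ s t, p s → p t → p (s + t)) (t) : p t := by
  refine induction B zero ?_ add t
  intro s l
  refine induction A (p := fun s => p (BalancedTensor.tmul B s l)) ?_ (fun m n => tmul m n l) ?_ s
  · rw [zero_tmul]; exact zero
  · intro s s' h h'
    rw [add_tmul]; exact add _ _ h h'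

theorem induction₃' [SMulCommClass A Bᵐᵒᵖ N] {p : BalancedTensor A M (BalancedTensor B N L) → Prop}
    (zero : p 0) (tmul : ∀ m n l, p (tmul A m (tmul B n l)))
    (add : ∀ s t, p s → p t → p (s + t)) (t) : p t := by
  refine induction A zero ?_ add t
  intro m s
  refine induction B (p := fun s => p (BalancedTensor.tmul A m s)) ?_ (tmul m) ?_ s
  · rw [tmul_zero]; exact zero
  · intro s s' h h'
    rw [tmul_add]; exact add _ _ h h'

variable (A B M N L) [SMulCommClass Bᵐᵒᵖ A N] [SMulCommClass A Bᵐᵒᵖ N]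

/-- The map `(m ⊗ n, l) ↦ m ⊗ (n ⊗ l)`. -/
noncomputable def assocCurried :
    BalancedTensor A M N →+ L →+ BalancedTensor A M (BalancedTensor B N L) :=
  lift (AddMonoidHom.mk' (fun m => AddMonoidHom.mk' (fun n => AddMonoidHom.mk'
      (fun l => tmul A m (tmul B n l)) (fun l l' => by rw [tmul_add, tmul_add]))
      (fun n n' => by ext l; simp [tmul_add, add_tmul]))
      (fun m m' => by ext n l; simp [add_tmul]))
      (fun m a n => by
        ext l
        exact smul_tmul A m a (tmul B n l))

/-- The map `(m, n ⊗ l) ↦ (m ⊗ n) ⊗ l`. -/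
noncomputable def assocInvCurried :
    M →+ BalancedTensor B N L →+ BalancedTensor B (BalancedTensor A M N) L :=
  AddMonoidHom.mk' (fun m => lift (AddMonoidHom.mk' (fun n => AddMonoidHom.mk'
      (fun l => tmul B (tmul A m n) l) (fun l l' => by rw [tmul_add]))
      (fun n n' => by ext l; simp [tmul_add, add_tmul]))
      (fun n b l => smul_tmul B (tmul A m n) b l))
      (fun m m' => hom_ext B fun n l => by
        change tmul B (tmul A (m + m') n) l = tmul B (tmul A m n) l + tmul B (tmul A m' n) l
        rw [add_tmul, add_tmul])

/-- The associativity map `(M ⊗_A N) ⊗_B L → M ⊗_A (N ⊗_B L)`. -/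
noncomputable def assocHom :
    BalancedTensor B (BalancedTensor A M N) L →+ BalancedTensor A M (BalancedTensor B N L) :=
  lift (assocCurried A B M N L) fun t b l => by
    refine induction A
      (p := fun t => assocCurried A B M N L (op b • t) l = assocCurried A B M N L t (b • l)) ?_ ?_ ?_ t
    · rw [smul_zero, map_zero, AddMonoidHom.zero_apply, AddMonoidHom.zero_apply]
    · intro m n
      exact congrArg (tmul A m) (smul_tmul B n b l)
    · intro t t' h h'
      rw [smul_add, map_add, map_add, AddMonoidHom.add_apply, AddMonoidHom.add_apply, h, h']

/-- The associativity map `M ⊗_A (N ⊗_B L) → (M ⊗_A N) ⊗_B L`. -/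
noncomputable def assocInv :
    BalancedTensor A M (BalancedTensor B N L) →+ BalancedTensor B (BalancedTensor A M N) L :=
  lift (assocInvCurried A B M N L) fun m a t => by
    refine induction B
      (p := fun t => assocInvCurried A B M N L (op a • m) t =
        assocInvCurried A B M N L m (a • t)) ?_ ?_ ?_ t
    · rw [smul_zero, map_zero, map_zero]
    · intro n l
      exact congrArg (fun z => tmul B z l) (smul_tmul A m a n)
    · intro t t' h h'
      rw [smul_add, map_add, map_add, h, h']

variable {A B M N L}

theorem assocInv_assocHom (t : BalancedTensor B (BalancedTensor A M N) L) :
    assocInv A B M N L (assocHom A B M N L t) = t :=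
  induction₃ (p := fun t => assocInv A B M N L (assocHom A B M N L t) = t)
    (by rw [map_zero, map_zero]) (fun _ _ _ => rfl)
    (fun s t h h' => by rw [map_add, map_add, h, h']) t

theorem assocHom_assocInv (t : BalancedTensor A M (BalancedTensor B N L)) :
    assocHom A B M N L (assocInv A B M N L t) = t :=
  induction₃' (p := fun t => assocHom A B M N L (assocInv A B M N L t) = t)
    (by rw [map_zero, map_zero]) (fun _ _ _ => rfl)
    (fun s t h h' => by rw [map_add, map_add, h, h']) t

theorem assocHom_bijective : Function.Bijective (assocHom A B M N L) :=
  Function.bijective_iff_has_inverse.2 ⟨_, assocInv_assocHom, assocHom_assocInv⟩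

end Assoc

section Unit

variable {A M N : Type u} [Ring A] [AddCommGroup M] [Module Aᵐᵒᵖ M] [AddCommGroup N] [Module A N]

/-- The action map `A ⊗_A N → N`. -/
noncomputable def lidHom (A N : Type u) [Ring A] [AddCommGroup N] [Module A N] :
    BalancedTensor A A N →+ N :=
  lift (AddMonoidHom.mk' (fun a => AddMonoidHom.mk' (fun y => a • y) (smul_add a))
    (fun a b => by ext y; exact add_smul a b y)) fun x a y => mul_smul x a y

theorem lidHom_tmul (a : A) (y : N) : lidHom A N (tmul A a y) = a • y := rfl

theorem lidHom_bijective : Function.Bijective (lidHom A N) := by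
  refine Function.bijective_iff_has_inverse.2 ⟨fun y => tmul A (1 : A) y, fun t => ?_, one_smul A⟩
  refine induction A (p := fun t => tmul A (1 : A) (lidHom A N t) = t) ?_ ?_ ?_ t
  · rw [map_zero, tmul_zero]
  · intro a y
    rw [lidHom_tmul, ← smul_tmul, op_smul_eq_mul, one_mul]
  · intro t t' h h'
    rw [map_add, tmul_add, h, h']

/-- The action map `M ⊗_A A → M`. -/
noncomputable def ridHom (A M : Type u) [Ring A] [AddCommGroup M] [Module Aᵐᵒᵖ M] :
    BalancedTensor A M A →+ M :=
  lift (AddMonoidHom.mk' (fun x => AddMonoidHom.mk' (fun a => op a • x)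
    (fun a b => by rw [MulOpposite.op_add, add_smul])) (fun x x' => by ext a; exact smul_add (op a) x x'))
    fun x a b => by
      change op b • op a • x = op (a * b) • x
      rw [MulOpposite.op_mul, mul_smul]

theorem ridHom_tmul (x : M) (a : A) : ridHom A M (tmul A x a) = op a • x := rfl

theorem ridHom_bijective : Function.Bijective (ridHom A M) := by
  refine Function.bijective_iff_has_inverse.2 ⟨fun x => tmul A x (1 : A), fun t => ?_, fun x => ?_⟩
  · refine induction A (p := fun t => tmul A (ridHom A M t) (1 : A) = t) ?_ ?_ ?_ t
    · rw [map_zero, zero_tmul]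
    · intro x a
      rw [ridHom_tmul, smul_tmul, smul_eq_mul, mul_one]
    · intro t t' h h'
      rw [map_add, add_tmul, h, h']
  · rw [ridHom_tmul, op_one, one_smul]

end Unit

end BalancedTensor

attribute [local instance] BalancedTensor.leftModule BalancedTensor.rightModule

/-! ### Tensoring almost isomorphisms on the left. -/

section TensorDimension

variable {K : Type v} [CommRing K] {δ : DimFunction.{v, u} K} {n : EReal} {A S : Type u} [Ring A]
  [Ring S] [Algebra K S] {X Y Z : Type u} [AddCommGroup X] [Module Aᵐᵒᵖ X]
  [AddCommGroup Y] [Module A Y] [Module S Y] [SMulCommClass S A Y]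
  [AddCommGroup Z] [Module A Z] [Module S Z] [SMulCommClass S A Z]

open BalancedTensor

namespace IsAlmostIso

/-- Tensoring with a finitely generated module on the left preserves bimodule maps with small
cokernel. -/
theorem mapRight_coker_le (hδ : IsExactDimension δ S) [Module.Finite Aᵐᵒᵖ X] (f : Y →ₗ[S] Z)
    (hf : ∀ (a : A) y, f (a • y) = a • f y) (h : δ S (Z ⧸ LinearMap.range f) ≤ n) :
    δ S (BalancedTensor A X Z ⧸
      LinearMap.range (mapRight (LinearMap.id : X →ₗ[Aᵐᵒᵖ] X) f hf)) ≤ n := by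
  obtain ⟨k, π, hπ⟩ := Module.Finite.exists_fin' Aᵐᵒᵖ X
  set T := LinearMap.range (mapRight (LinearMap.id : X →ₗ[Aᵐᵒᵖ] X) f hf)
  -- Each of the `k` generators of `X` contributes one image of the cokernel of `f`, and these
  -- images together span the cokernel of `X ⊗ f`.
  let g : Fin k → (Z ⧸ LinearMap.range f) →ₗ[S] (BalancedTensor A X Z ⧸ T) := fun i =>
    (LinearMap.range f).mapQ T (mkRight S (π (Pi.single i 1))) (by
      rintro _ ⟨y, rfl⟩
      exact ⟨tmul A _ y, rfl⟩)
  refine hδ.le_of_sum_surjective g (fun t => ?_) h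
  obtain ⟨t, rfl⟩ := Submodule.Quotient.mk_surjective _ t
  refine BalancedTensor.induction A (p := fun t => ∃ x : Fin k → Z ⧸ LinearMap.range f,
    (Submodule.Quotient.mk t : BalancedTensor A X Z ⧸ T) = ∑ i, g i (x i)) ⟨0, by simp⟩ ?_ ?_ t
  · intro x z
    obtain ⟨c, rfl⟩ := hπ x
    refine ⟨fun i => Submodule.Quotient.mk (unop (c i) • z), ?_⟩
    have hc : π c = ∑ i, c i • π (Pi.single i 1) := by
      simp only [← map_smul, ← map_sum]
      congr 1
      ext i
      simp [Finset.sum_apply, Pi.single_apply]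
    have : tmul A (π c) z = ∑ i, tmul A (π (Pi.single i 1)) (unop (c i) • z) := by
      simp only [← smul_tmul, op_unop]
      change (mkHom A X Z).flip z (π c) = ∑ i, (mkHom A X Z).flip z _
      rw [← map_sum, ← hc]
    rw [this]
    exact map_sum T.mkQ _ _
  · rintro t t' ⟨x, hx⟩ ⟨x', hx'⟩
    exact ⟨x + x', by simp [hx, hx', Finset.sum_add_distrib]⟩

/-- Tensoring with a finitely generated module on the left preserves bimodule maps with small kernel
and cokernel. -/
theorem mapRight [IsNoetherianRing Aᵐᵒᵖ] (hδ : IsExactDimension δ S) [Module.Finite Aᵐᵒᵖ X]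
    {f : Y →ₗ[S] Z} (hf : ∀ (a : A) y, f (a • y) = a • f y) (h : IsAlmostIso δ n f) :
    IsAlmostIso δ n (BalancedTensor.mapRight (LinearMap.id : X →ₗ[Aᵐᵒᵖ] X) f hf) := by
  refine ⟨?_, mapRight_coker_le hδ f hf h.coker_le⟩
  obtain ⟨k, π, hπ⟩ := Module.Finite.exists_fin' Aᵐᵒᵖ X
  have : Module.Finite Aᵐᵒᵖ (LinearMap.ker π) := inferInstance
  -- Compare the presentations `ker π → A^k → X` tensored with `Y` and with `Z`. The cokernel bound
  -- already proved applies to the finitely generated module `ker π`.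
  refine IsAlmostIso.four_lemma hδ (v₁ := rTensor S Y π)
    (u₁ := rTensor S Y (LinearMap.ker π).subtype)
    (u₂ := rTensor S Z (LinearMap.ker π).subtype) (v₂ := rTensor S Z π)
    (α := BalancedTensor.mapRight LinearMap.id f hf)
    (β := BalancedTensor.mapRight LinearMap.id f hf) ?_ ?_ ?_ ?_ ?_
    (mapRight_coker_le hδ f hf h.coker_le) ?_
  · exact map_surjective hπ Function.surjective_id
  · refine linearMap_ext fun x y => ?_
    change tmul A (π x.1) y = 0
    rw [x.2, zero_tmul]
  · intro t ht
    obtain ⟨s, hs⟩ := exists_of_map_left_eq_zero (f := (LinearMap.ker π).subtype)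
      (LinearMap.exact_subtype_ker_map π) hπ t ht
    exact ⟨s, hs⟩
  · exact linearMap_ext fun _ _ => rfl
  · exact linearMap_ext fun _ _ => rfl
  -- On the free module, `β` is `f` in each coordinate, so its kernel embeds in a power of `ker f`.
  · set β := BalancedTensor.mapRight (LinearMap.id : (Fin k → Aᵐᵒᵖ) →ₗ[Aᵐᵒᵖ] _) f hf
    have hβ : ∀ t i, piCoord A S Z (Fin k) (β t) i = f (piCoord A S Y (Fin k) t i) := fun t i => by
      have : (LinearMap.proj i ∘ₗ piCoord A S Z (Fin k)) ∘ₗ β =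
          f ∘ₗ (LinearMap.proj i ∘ₗ piCoord A S Y (Fin k)) :=
        linearMap_ext fun x y => (hf _ y).symm
      exact LinearMap.congr_fun this t
    refine hδ.le_of_injective (f := LinearMap.pi (φ := fun _ : Fin k => LinearMap.ker f)
      fun i => (LinearMap.proj i ∘ₗ piCoord A S Y (Fin k) ∘ₗ
        (LinearMap.ker β).subtype).codRestrict (LinearMap.ker f) fun t => ?_) ?_
      (hδ.pi_le h.ker_le)
    · have := hβ t.1 i
      rw [t.2, map_zero, Pi.zero_apply] at this
      exact this.symm
    · intro t t' htt
      refine Subtype.ext (piCoord_injective (S := S) (Fin k) (funext fun i => ?_))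
      exact congrArg Subtype.val (congrFun htt i)

end IsAlmostIso

end TensorDimension

/-! ### Tor and tensoring almost isomorphisms on the right. -/

section Tor

/-- If `S.X₂ → S.X₃` factors as a surjection `D` killing the boundaries followed by `ι`, then the
kernel of `ι` is a homomorphic image of the homology of `S`. -/
theorem CategoryTheory.ShortComplex.exists_surjective_of_homology {R : Type u} [Ring R]
    (S : ShortComplex (ModuleCat.{u} R)) {L : Type u} [AddCommGroup L] [Module R L]
    (D : S.X₂ →ₗ[R] L) (ι : L →ₗ[R] S.X₃) (hD : Function.Surjective D) (hι : ι ∘ₗ D = S.g.hom)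
    (hf : D ∘ₗ S.f.hom = 0) :
    ∃ q : S.homology →ₗ[R] LinearMap.ker ι, Function.Surjective q := by
  let e := S.moduleCatHomologyIso.toLinearEquiv
  have hιD : ∀ t, ι (D t) = S.g.hom t := LinearMap.congr_fun hι
  let q₀ : LinearMap.ker S.g.hom →ₗ[R] LinearMap.ker ι :=
    (D ∘ₗ Submodule.subtype _).codRestrict _ fun t => (hιD t.1).trans t.2
  let q : (LinearMap.ker S.g.hom ⧸ LinearMap.range S.moduleCatToCycles) →ₗ[R] LinearMap.ker ι :=
    Submodule.liftQ _ q₀ (by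
      rintro _ ⟨t, rfl⟩
      exact Subtype.ext (LinearMap.congr_fun hf t))
  refine ⟨q ∘ₗ e.toLinearMap, Function.Surjective.comp (g := q) ?_ e.surjective⟩
  rintro ⟨s, hs⟩
  obtain ⟨t, rfl⟩ := hD s
  exact ⟨Submodule.Quotient.mk ⟨t, (hιD t).symm.trans hs⟩, rfl⟩

variable {K : Type v} [CommRing K] {A B : Type u} [Ring A] [Algebra K A] [Ring B] [Algebra K B]

open BalancedTensor

namespace CentralBimodule

/-- Right exactness is what identifies the zeroth left derived functor with the tensor product
itself. -/
instance (N : CentralBimodule K A B) : Limits.PreservesFiniteColimits (tensorRight N) := by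
  refine ((tensorRight N).preservesFiniteColimits_tfae.out 0 3 :).1 ?_
  intro S hS
  constructor
  · rw [ShortComplex.moduleCat_exact_iff]
    intro t ht
    exact exists_of_map_left_eq_zero (f := S.f.hom) (f' := S.g.hom)
      ((ShortComplex.ShortExact.moduleCat_exact_iff_function_exact S).1 hS.exact)
      hS.moduleCat_surjective_g t ht
  · rw [ModuleCat.epi_iff_surjective]
    exact map_surjective hS.moduleCat_surjective_g Function.surjective_id

theorem tensorRight_small_of_torRight {δ : DimFunction.{v, u} K} {n : EReal}
    (hδ : IsExactDimension δ Bᵐᵒᵖ) (N : CentralBimodule K A B) (Z : ModuleCat.{u} Aᵐᵒᵖ)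
    (h : δ Bᵐᵒᵖ (N.torRight 0 Z) ≤ n) : δ Bᵐᵒᵖ (BalancedTensor A Z N) ≤ n := by
  have e := ((tensorRight N).leftDerivedZeroIsoSelf.app Z).toLinearEquiv
  exact hδ.le_of_surjective (f := e.toLinearMap) e.surjective h

/-- The kernel of `L ⊗ N → F ⊗ N`, for the kernel `L` of some surjection `F → Z` from a
projective module, is a homomorphic image of `Tor₁(Z, N)`. -/
theorem exists_presentation_of_torRight (N : CentralBimodule K A B) (Z : ModuleCat.{u} Aᵐᵒᵖ) :
    ∃ (F : ModuleCat.{u} Aᵐᵒᵖ) (π : F →ₗ[Aᵐᵒᵖ] Z), Module.Projective Aᵐᵒᵖ F ∧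
      Function.Surjective π ∧ ∃ q : N.torRight 1 Z →ₗ[Bᵐᵒᵖ]
        LinearMap.ker (rTensor Bᵐᵒᵖ N (LinearMap.ker π).subtype), Function.Surjective q := by
  obtain ⟨P⟩ := (inferInstance : HasProjectiveResolution Z).out
  let π : P.complex.X 0 →ₗ[Aᵐᵒᵖ] Z := (P.π.f 0).hom
  have hexact := P.exact₀
  have hπ : Function.Surjective π := (ModuleCat.epi_iff_surjective _).1
    (inferInstanceAs (Epi (P.π.f 0)))
  refine ⟨P.complex.X 0, π, ?_, hπ, ?_⟩
  · exact (IsProjective.iff_projective _).2 (P.projective 0)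
  let d : P.complex.X 1 →ₗ[Aᵐᵒᵖ] LinearMap.ker π :=
    (P.complex.d 1 0).hom.codRestrict _ fun x =>
      LinearMap.congr_fun (congrArg ModuleCat.Hom.hom P.complex_d_comp_π_f_zero) x
  have hd : Function.Surjective d := by
    rintro ⟨x, hx⟩
    obtain ⟨y, hy⟩ := (ShortComplex.moduleCat_exact_iff _).1 hexact x hx
    exact ⟨y, Subtype.ext hy⟩
  have hdd : d ∘ₗ (P.complex.d 2 1).hom = 0 := by
    ext x
    change (P.complex.d 1 0).hom ((P.complex.d 2 1).hom x) = 0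
    exact LinearMap.congr_fun (congrArg ModuleCat.Hom.hom (P.complex.d_comp_d 2 1 0)) x
  let T := ((tensorRight N).mapHomologicalComplex (ComplexShape.down ℕ)).obj P.complex
  let e₁ := P.isoLeftDerivedObj (tensorRight N) 1
  let e₂ := T.homologyIsoSc' 2 1 0 (by simp) (by simp)
  let e := (e₁ ≪≫ e₂).toLinearEquiv
  let D : BalancedTensor A (P.complex.X 1) N →ₗ[Bᵐᵒᵖ] BalancedTensor A (LinearMap.ker π) N :=
    rTensor Bᵐᵒᵖ N d
  -- Right exactness makes `D : P₁ ⊗ N → ker π ⊗ N` surjective, and the differential `P₁ ⊗ N → P₀ ⊗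
  -- N` factors through it; `Tor₁` is the homology at `P₁ ⊗ N`.
  obtain ⟨q, hq⟩ := (T.sc' 2 1 0).exists_surjective_of_homology D
    (rTensor Bᵐᵒᵖ N (LinearMap.ker π).subtype) (map_surjective hd Function.surjective_id)
    (linearMap_ext fun _ _ => rfl) (linearMap_ext fun x y => by
      change tmul A (d ((P.complex.d 2 1).hom x)) y = 0
      rw [show d ((P.complex.d 2 1).hom x) = 0 from LinearMap.congr_fun hdd x, zero_tmul])
  exact ⟨q ∘ₗ e.toLinearMap, hq.comp e.surjective⟩

end CentralBimodule

variable {δ : DimFunction.{v, u} K} {n : EReal} {X Y : Type u} [AddCommGroup X] [Module Aᵐᵒᵖ X]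
  [AddCommGroup Y] [Module Aᵐᵒᵖ Y]

theorem GammaCondition.tensor_le (hγ : GammaCondition δ n 1 A B) (hδ : IsExactDimension δ Bᵐᵒᵖ)
    {N : CentralBimodule K A B} (hN : N.IsFG) [Module.Finite Aᵐᵒᵖ X] (hX : δ Aᵐᵒᵖ X ≤ n) :
    δ Bᵐᵒᵖ (BalancedTensor A X N) ≤ n :=
  CentralBimodule.tensorRight_small_of_torRight hδ N (ModuleCat.of Aᵐᵒᵖ X)
    (((hγ N hN).1 (ModuleCat.of Aᵐᵒᵖ X) ⟨inferInstance, hX⟩ 0 zero_le_one).2)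

/-- If `Y/X` is small, then the kernel of `X ⊗ N → Y ⊗ N` is small. -/
theorem GammaCondition.ker_rTensor_le (hγ : GammaCondition δ n 1 A B)
    (hδ : IsExactDimension δ Bᵐᵒᵖ) {N : CentralBimodule K A B} (hN : N.IsFG)
    [Module.Finite Aᵐᵒᵖ Y] (I : Submodule Aᵐᵒᵖ Y) (hI : δ Aᵐᵒᵖ (Y ⧸ I) ≤ n) :
    δ Bᵐᵒᵖ (LinearMap.ker (rTensor Bᵐᵒᵖ N I.subtype)) ≤ n := by
  obtain ⟨F, π, hF, hπ, q, hq⟩ :=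
    N.exists_presentation_of_torRight (ModuleCat.of Aᵐᵒᵖ (Y ⧸ I))
  have hL := hδ.le_of_surjective hq
    (((hγ N hN).1 (ModuleCat.of Aᵐᵒᵖ (Y ⧸ I)) ⟨inferInstanceAs (Module.Finite Aᵐᵒᵖ (Y ⧸ I)), hI⟩ 1
      le_rfl).2)
  -- Lifting `π` to `Y` yields the exact sequence `ker π → I × F → Y → 0`. If `t` dies in `Y ⊗ N`,
  -- then `(t, 0)` comes from some `κ` in `ker π ⊗ N`. Its second coordinate says that `κ` dies in
  -- `F ⊗ N`, its first that `t` is the image of `κ`. Thus the kernel in question is bounded by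
  -- `Tor₁`.
  obtain ⟨l, hl⟩ := Module.projective_lifting_property I.mkQ π I.mkQ_surjective
  have hl' : ∀ x, (Submodule.Quotient.mk (l x) : Y ⧸ I) = π x := LinearMap.congr_fun hl
  let lK : LinearMap.ker π →ₗ[Aᵐᵒᵖ] I := (l ∘ₗ (LinearMap.ker π).subtype).codRestrict I fun x => by
    have := hl' x.1
    rw [x.2, Submodule.Quotient.mk_eq_zero] at this
    exact this
  let j : LinearMap.ker π →ₗ[Aᵐᵒᵖ] I × F := (-lK).prod (LinearMap.ker π).subtype
  let s : I × F →ₗ[Aᵐᵒᵖ] Y := I.subtype.coprod l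
  have hs : Function.Surjective s := fun y => by
    obtain ⟨x, hx⟩ := hπ (Submodule.Quotient.mk y)
    have : y - l x ∈ I := by rw [← Submodule.Quotient.eq, hl', hx]
    exact ⟨(⟨_, this⟩, x), by simp [s]⟩
  have hjs : Function.Exact j s := fun z => by
    constructor
    · intro hz
      have hz' : (z.1 : Y) + l z.2 = 0 := hz
      have hz₂ : π z.2 = 0 := by
        rw [← hl', Submodule.Quotient.mk_eq_zero, ← neg_eq_of_add_eq_zero_right hz']
        exact I.neg_mem z.1.2
      refine ⟨⟨z.2, hz₂⟩, Prod.ext (Subtype.ext ?_) rfl⟩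
      exact (eq_neg_of_add_eq_zero_left hz').symm
    · rintro ⟨x, rfl⟩
      exact neg_add_cancel (l x.1)
  refine hδ.le_of_injective (f := LinearMap.id) Function.injective_id ?_
  refine hδ.submodule_mono (T := (LinearMap.ker (rTensor Bᵐᵒᵖ N (LinearMap.ker π).subtype)).map
    (rTensor Bᵐᵒᵖ N (-lK))) ?_ (hδ.map_le _ hL)
  intro t ht
  have h₁ : rTensor Bᵐᵒᵖ N s (rTensor Bᵐᵒᵖ N (LinearMap.inl Aᵐᵒᵖ I F) t) = 0 := by
    rw [← LinearMap.comp_apply, ← rTensor_comp]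
    have : s ∘ₗ LinearMap.inl Aᵐᵒᵖ I F = I.subtype := by ext; simp [s]
    rw [this]
    exact ht
  obtain ⟨κ, hκ⟩ := exists_of_map_left_eq_zero hjs hs _ h₁
  have hκ' : rTensor Bᵐᵒᵖ N j κ = rTensor Bᵐᵒᵖ N (LinearMap.inl Aᵐᵒᵖ I F) t := hκ
  refine ⟨κ, ?_, ?_⟩
  · have := congrArg (rTensor Bᵐᵒᵖ N (LinearMap.snd Aᵐᵒᵖ I F)) hκ'
    rw [← LinearMap.comp_apply, ← LinearMap.comp_apply, ← rTensor_comp, ← rTensor_comp,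
      LinearMap.snd_comp_inl] at this
    refine (show rTensor Bᵐᵒᵖ N (LinearMap.ker π).subtype κ = _ from this).trans ?_
    refine BalancedTensor.induction A (p := fun t => rTensor Bᵐᵒᵖ N (0 : I →ₗ[Aᵐᵒᵖ] F) t = 0)
      (map_zero _) (fun x y => zero_tmul A y) (fun t t' h h' => by rw [map_add, h, h', add_zero]) t
  · have := congrArg (rTensor Bᵐᵒᵖ N (LinearMap.fst Aᵐᵒᵖ I F)) hκ'
    rw [← LinearMap.comp_apply, ← LinearMap.comp_apply, ← rTensor_comp, ← rTensor_comp,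
      LinearMap.fst_comp_inl] at this
    refine (show rTensor Bᵐᵒᵖ N (-lK) κ = _ from this).trans ?_
    exact DFunLike.congr_fun (BalancedTensor.map_id A) t

/-- Factor `f` through its image. `Tor₀` of the kernel controls the surjection, `Tor₁` of the
cokernel controls the inclusion, and the cokernel of `f ⊗ N` embeds in the cokernel of `f` tensored
with `N`. -/
theorem IsAlmostIso.rTensor [IsNoetherianRing Aᵐᵒᵖ] (hγ : GammaCondition δ n 1 A B)
    (hδ : IsExactDimension δ Bᵐᵒᵖ) {N : CentralBimodule K A B} (hN : N.IsFG)
    [Module.Finite Aᵐᵒᵖ X] [Module.Finite Aᵐᵒᵖ Y] {f : X →ₗ[Aᵐᵒᵖ] Y} (hf : IsAlmostIso δ n f) :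
    IsAlmostIso δ n (BalancedTensor.rTensor Bᵐᵒᵖ N f) := by
  constructor
  · have h₁ : δ Bᵐᵒᵖ (LinearMap.ker (BalancedTensor.rTensor Bᵐᵒᵖ N f.rangeRestrict)) ≤ n := by
      refine hδ.submodule_mono (T := LinearMap.range (BalancedTensor.rTensor Bᵐᵒᵖ N
        (LinearMap.ker f).subtype)) (fun t ht => ?_)
        (hδ.le_of_surjective (LinearMap.surjective_rangeRestrict _) (hγ.tensor_le hδ hN hf.ker_le))
      have hex : Function.Exact (LinearMap.ker f).subtype f.rangeRestrict := fun x => by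
        rw [Submodule.coe_subtype, Subtype.range_coe_subtype, ← Subtype.coe_inj]
        rfl
      exact exists_of_map_left_eq_zero hex f.surjective_rangeRestrict t ht
    have h₂ := hγ.ker_rTensor_le hδ hN (LinearMap.range f) hf.coker_le
    refine hδ.le_of_ker_le_range (Submodule.inclusion ?_)
      ((BalancedTensor.rTensor Bᵐᵒᵖ N f.rangeRestrict).restrict
        (p := LinearMap.ker (BalancedTensor.rTensor Bᵐᵒᵖ N f))
        (q := LinearMap.ker (BalancedTensor.rTensor Bᵐᵒᵖ N (LinearMap.range f).subtype)) ?_) ?_ h₁ h₂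
    · intro t ht
      have := rTensor_comp (S := Bᵐᵒᵖ) (N := N) f.rangeRestrict (LinearMap.range f).subtype
      change BalancedTensor.rTensor Bᵐᵒᵖ N f t = 0
      refine (LinearMap.congr_fun this t).trans ?_
      rw [LinearMap.comp_apply, ht, map_zero]
    · intro t ht
      have := rTensor_comp (S := Bᵐᵒᵖ) (N := N) f.rangeRestrict (LinearMap.range f).subtype
      exact (LinearMap.congr_fun this t).symm.trans ht
    · rintro ⟨t, ht⟩ ht'
      exact ⟨⟨t, congrArg Subtype.val ht'⟩, rfl⟩
  · have hex : Function.Exact f (LinearMap.range f).mkQ := LinearMap.exact_map_mkQ_range f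
    refine hδ.le_of_injective (f := Submodule.liftQ _
      (BalancedTensor.rTensor Bᵐᵒᵖ N (LinearMap.range f).mkQ) ?_) ?_
      (hγ.tensor_le hδ hN hf.coker_le)
    · rintro _ ⟨t, rfl⟩
      rw [LinearMap.mem_ker, ← LinearMap.comp_apply, ← rTensor_comp]
      have : (LinearMap.range f).mkQ ∘ₗ f = 0 := LinearMap.range_mkQ_comp f
      rw [this]
      exact BalancedTensor.induction A (p := fun t => BalancedTensor.rTensor Bᵐᵒᵖ N
        (0 : X →ₗ[Aᵐᵒᵖ] Y ⧸ LinearMap.range f) t = 0)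
        (map_zero _) (fun x y => zero_tmul A y) (fun t t' h h' => by rw [map_add, h, h', add_zero]) t
    · refine LinearMap.ker_eq_bot.1 (Submodule.ker_liftQ_eq_bot _ _ _ fun t ht => ?_)
      exact exists_of_map_left_eq_zero hex (Submodule.mkQ_surjective _) t ht

end Tor

/-! ### Grade, and Ext of a short exact sequence. -/

section Ext

open Abelian

variable {R : Type u} [Ring R] {X Y Z D T : Type u} [AddCommGroup X] [Module R X]
  [AddCommGroup Y] [Module R Y] [AddCommGroup Z] [Module R Z] [AddCommGroup D] [Module R D]
  [AddCommGroup T] [Module R T]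

theorem le_gradeNumber_iff {q : ℕ} :
    (q : ℕ∞) ≤ gradeNumber R D X ↔ ∀ i < q, Subsingleton (ExtTo R D X i) := by
  constructor
  · intro h i hi
    by_contra hn
    rw [not_subsingleton_iff_nontrivial] at hn
    have : gradeNumber R D X ≤ i := sInf_le ⟨i, rfl, hn⟩
    exact absurd (h.trans this) (by exact_mod_cast not_le.2 hi)
  · rintro h
    refine le_sInf ?_
    rintro _ ⟨i, rfl, hi⟩
    by_contra hlt
    exact not_subsingleton_iff_nontrivial.2 hi (h i (by exact_mod_cast not_le.1 hlt))

theorem extTo_zero_subsingleton_iff :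
    Subsingleton (ExtTo R D X 0) ↔ ∀ f : X →ₗ[R] D, f = 0 := by
  constructor
  · intro h f
    have := (Ext.mk₀_bijective (ModuleCat.of R X) (ModuleCat.of R D)).1
      (Subsingleton.elim (Ext.mk₀ (ModuleCat.ofHom f)) (Ext.mk₀ (ModuleCat.ofHom 0)))
    exact congrArg ModuleCat.Hom.hom this
  · intro h
    refine ⟨fun a b => ?_⟩
    obtain ⟨a, rfl⟩ := (Ext.mk₀_bijective _ _).2 a
    obtain ⟨b, rfl⟩ := (Ext.mk₀_bijective _ _).2 b
    rw [← ModuleCat.ofHom_hom a, ← ModuleCat.ofHom_hom b, h a.hom, h b.hom]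

theorem Function.Exact.shortExact_moduleCat {f : X →ₗ[R] Y} {g : Y →ₗ[R] Z}
    (h : Function.Exact f g) (hf : Function.Injective f) (hg : Function.Surjective g) :
    (ModuleCat.shortComplexOfCompEqZero f g h.linearMap_comp_eq_zero).ShortExact :=
  ModuleCat.shortComplex_shortExact _ h hf hg

/-- If the extension class of a short exact sequence becomes trivial along `k`, then `k` extends. -/
theorem exists_comp_eq_of_extClass_comp_eq_zero {f : X →ₗ[R] Y} {g : Y →ₗ[R] Z}
    (h : Function.Exact f g) (hf : Function.Injective f) (hg : Function.Surjective g)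
    (k : X →ₗ[R] D)
    (hk : (h.shortExact_moduleCat hf hg).extClass.comp (Ext.mk₀ (ModuleCat.ofHom k))
      (add_zero 1) = 0) :
    ∃ k' : Y →ₗ[R] D, k' ∘ₗ f = k := by
  obtain ⟨y, hy⟩ := Ext.contravariant_sequence_exact₁ (h.shortExact_moduleCat hf hg) _
    (Ext.mk₀ (ModuleCat.ofHom k)) (add_zero 1) hk
  obtain ⟨y, rfl⟩ := (Ext.mk₀_bijective _ _).2 y
  rw [Ext.mk₀_comp_mk₀] at hy
  exact ⟨y.hom, congrArg ModuleCat.Hom.hom ((Ext.mk₀_bijective _ _).1 hy)⟩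

theorem exists_comp_eq_of_subsingleton_ext {f : X →ₗ[R] Y} {g : Y →ₗ[R] Z}
    (h : Function.Exact f g) (hf : Function.Injective f) (hg : Function.Surjective g)
    (hZ : Subsingleton (ExtTo R D Z 1)) (k : X →ₗ[R] D) : ∃ k' : Y →ₗ[R] D, k' ∘ₗ f = k :=
  exists_comp_eq_of_extClass_comp_eq_zero h hf hg k (Subsingleton.elim (α := ExtTo R D Z 1) _ _)

/-- For projective `Y`, `Ext¹(Z, D)` consists of the obstructions to extending maps `X → D` to `Y`.
-/
theorem subsingleton_ext_one_of_projective {f : X →ₗ[R] Y} {g : Y →ₗ[R] Z}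
    (h : Function.Exact f g) (hf : Function.Injective f) (hg : Function.Surjective g)
    [Module.Projective R Y] (hX : ∀ k : X →ₗ[R] D, ∃ k' : Y →ₗ[R] D, k' ∘ₗ f = k) :
    Subsingleton (ExtTo R D Z 1) := by
  have : Projective (ModuleCat.of R Y) := (IsProjective.iff_projective Y).1 inferInstance
  refine subsingleton_of_forall_eq 0 fun z => ?_
  obtain ⟨x, rfl⟩ := Ext.contravariant_sequence_exact₃ (h.shortExact_moduleCat hf hg) _ z
    ((Ext.mk₀ _).comp z (zero_add 1)).eq_zero_of_projective (add_zero 1)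
  obtain ⟨x, rfl⟩ := (Ext.mk₀_bijective _ _).2 x
  obtain ⟨k', hk'⟩ := hX x.hom
  have : x = ModuleCat.ofHom f ≫ ModuleCat.ofHom k' := ModuleCat.hom_ext hk'.symm
  rw [this, ← Ext.mk₀_comp_mk₀]
  exact (h.shortExact_moduleCat hf hg).extClass_comp_assoc _

/-- Dimension shifting, as `X` is a syzygy of `Z`. -/
theorem subsingleton_ext_of_subsingleton_ext_succ {f : X →ₗ[R] Y} {g : Y →ₗ[R] Z}
    (h : Function.Exact f g) (hf : Function.Injective f) (hg : Function.Surjective g)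
    [Module.Projective R Y] {k : ℕ} (hZ : Subsingleton (ExtTo R D Z (k + 2))) :
    Subsingleton (ExtTo R D X (k + 1)) := by
  have : Projective (ModuleCat.of R Y) := (IsProjective.iff_projective Y).1 inferInstance
  refine subsingleton_of_forall_eq 0 fun x => ?_
  obtain ⟨y, rfl⟩ := Ext.contravariant_sequence_exact₁ (h.shortExact_moduleCat hf hg) _ x
    (n₁ := k + 2) (by omega) (Subsingleton.elim (α := ExtTo R D Z (k + 2)) _ _)
  rw [y.eq_zero_of_projective, Ext.comp_zero]

end Ext

/-! ### Finitely generated projectives, and projective dimension detected by Ext into the ring. -/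

section Retract

/-- `C` as a right module over itself, compared with `Cᵐᵒᵖ` as a left module over itself. -/
def opLinearEquivSelf (C : Type u) [Ring C] : Cᵐᵒᵖ ≃ₗ[Cᵐᵒᵖ] C where
  toFun := unop
  map_add' _ _ := rfl
  map_smul' _ _ := rfl
  invFun := op
  left_inv _ := rfl
  right_inv _ := rfl

instance Module.Projective.right_self (C : Type u) [Ring C] : Module.Projective Cᵐᵒᵖ C :=
  Module.Projective.of_equiv (opLinearEquivSelf C)

instance Module.Finite.right_self (C : Type u) [Ring C] : Module.Finite Cᵐᵒᵖ C :=
  Module.Finite.equiv (opLinearEquivSelf C)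

theorem Module.Projective.pi_const {R P : Type*} [Ring R] [AddCommGroup P] [Module R P]
    [Module.Projective R P] {ι : Type*} [Finite ι] : Module.Projective R (ι → P) := by
  classical
  have := Fintype.ofFinite ι
  exact Module.Projective.of_equiv (DFinsupp.linearEquivFunOnFintype (R := R) (M := fun _ : ι => P))

theorem exists_retract_pi {R P C : Type*} [Ring R] [AddCommGroup P] [Module R P] [AddCommGroup C]
    [Module R C] (e : R ≃ₗ[R] C) [Module.Finite R P] [Module.Projective R P] :
    ∃ (k : ℕ) (i : P →ₗ[R] (Fin k → C)) (r : (Fin k → C) →ₗ[R] P), r ∘ₗ i = LinearMap.id := by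
  obtain ⟨k, π, hπ⟩ := Module.Finite.exists_fin' R P
  obtain ⟨s, hs⟩ := Module.projective_lifting_property π LinearMap.id hπ
  let e' : (Fin k → R) ≃ₗ[R] (Fin k → C) := LinearEquiv.piCongrRight fun _ => e
  refine ⟨k, e'.toLinearMap ∘ₗ s, π ∘ₗ e'.symm.toLinearMap, ?_⟩
  ext x
  simpa using LinearMap.congr_fun hs x

end Retract

section ProjectiveDimension

open Abelian

variable {C : Type u} [Ring C]

/-- For a finitely generated module of projective dimension at most `k + 1`, the group `Ext^(k+1)`
into `C` decides whether the dimension drops. Dimension shifting reduces to `k = 0`, where the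
syzygy is finitely generated projective and thus a retract of a power of `C`. -/
theorem hasProjectiveDimensionLT_of_subsingleton_ext [IsNoetherianRing Cᵐᵒᵖ] (k : ℕ) :
    ∀ (X : Type u) [AddCommGroup X] [Module Cᵐᵒᵖ X], Module.Finite Cᵐᵒᵖ X →
      HasProjectiveDimensionLT (ModuleCat.of Cᵐᵒᵖ X) (k + 2) →
      Subsingleton (ExtTo Cᵐᵒᵖ C X (k + 1)) →
      HasProjectiveDimensionLT (ModuleCat.of Cᵐᵒᵖ X) (k + 1) := by
  induction k with
  | zero =>
    intro X _ _ hX hpd hext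
    obtain ⟨m, π, hπ⟩ := Module.Finite.exists_fin' Cᵐᵒᵖ X
    have hex := LinearMap.exact_subtype_ker_map π
    have hF : Projective (ModuleCat.of Cᵐᵒᵖ (Fin m → Cᵐᵒᵖ)) :=
      (IsProjective.iff_projective _).1 Module.Projective.pi_const
    have hS := hex.shortExact_moduleCat (Submodule.subtype_injective _) hπ
    have hK : Module.Projective Cᵐᵒᵖ (LinearMap.ker π) := by
      have := (hS.hasProjectiveDimensionLT_X₃_iff 0 hF).1 hpd
      exact (IsProjective.iff_projective _).2 (projective_iff_hasProjectiveDimensionLT_one.2 this)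
    obtain ⟨l, i, r, hri⟩ := exists_retract_pi (P := LinearMap.ker π) (opLinearEquivSelf C)
    -- Vanishing of `Ext¹(X, C)` extends each coordinate of the embedding of the syzygy into `C^l`;
    -- composed with the retraction, this splits the presentation.
    choose i' hi' using fun a : Fin l =>
      exists_comp_eq_of_subsingleton_ext hex (Submodule.subtype_injective _) hπ hext
        (LinearMap.proj a ∘ₗ i)
    have hsplit : (r ∘ₗ LinearMap.pi i') ∘ₗ (LinearMap.ker π).subtype = LinearMap.id := by
      rw [← hri, LinearMap.comp_assoc]
      congr 1
      ext x a
      exact LinearMap.congr_fun (hi' a) x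
    obtain ⟨s, hs⟩ : ∃ s, π ∘ₗ s = LinearMap.id :=
      ((hex.split_tfae'.out 1 0 :).1 ⟨hπ, _, hsplit⟩).2
    have : Module.Projective Cᵐᵒᵖ X := by
      have : Module.Projective Cᵐᵒᵖ (Fin m → Cᵐᵒᵖ) := Module.Projective.pi_const
      exact Module.Projective.of_split s π hs
    exact projective_iff_hasProjectiveDimensionLT_one.1
      ((IsProjective.iff_projective X).1 this)
  | succ k ih =>
    intro X _ _ hX hpd hext
    obtain ⟨m, π, hπ⟩ := Module.Finite.exists_fin' Cᵐᵒᵖ X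
    have hex := LinearMap.exact_subtype_ker_map π
    have : Module.Projective Cᵐᵒᵖ (Fin m → Cᵐᵒᵖ) := Module.Projective.pi_const
    have hF : Projective (ModuleCat.of Cᵐᵒᵖ (Fin m → Cᵐᵒᵖ)) :=
      (IsProjective.iff_projective _).1 this
    have hS := hex.shortExact_moduleCat (Submodule.subtype_injective _) hπ
    refine (hS.hasProjectiveDimensionLT_X₃_iff k hF).2 (ih (LinearMap.ker π) inferInstance
      ((hS.hasProjectiveDimensionLT_X₃_iff (k + 1) hF).1 hpd)
      (subsingleton_ext_of_subsingleton_ext_succ hex (Submodule.subtype_injective _) hπ hext))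

/-- Finite global dimension supplies some bound, from which one descends one degree at a time to
`d`. -/
theorem hasProjectiveDimensionLT_of_ext_vanishing [IsNoetherianRing Cᵐᵒᵖ]
    (hgl : ∃ n : ℕ, globalDim C = n) {X : Type u} [AddCommGroup X] [Module Cᵐᵒᵖ X]
    [Module.Finite Cᵐᵒᵖ X] {d : ℕ} (hext : ∀ q, d < q → Subsingleton (ExtTo Cᵐᵒᵖ C X q)) :
    HasProjectiveDimensionLT (ModuleCat.of Cᵐᵒᵖ X) (d + 1) := by
  obtain ⟨n, hn⟩ := hgl
  have hle : projectiveDimension (ModuleCat.of Cᵐᵒᵖ X) ≤ n :=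
    (le_iSup (fun M : ModuleCat.{u} Cᵐᵒᵖ => projectiveDimension M) (ModuleCat.of Cᵐᵒᵖ X)).trans
      hn.le
  have h₀ : HasProjectiveDimensionLT (ModuleCat.of Cᵐᵒᵖ X) (n + 1) :=
    (projectiveDimension_le_iff _ _).1 hle
  have key : ∀ m, HasProjectiveDimensionLT (ModuleCat.of Cᵐᵒᵖ X) (d + 1 + m) →
      HasProjectiveDimensionLT (ModuleCat.of Cᵐᵒᵖ X) (d + 1) := by
    intro m
    induction m with
    | zero => exact id
    | succ m ih =>
      intro h
      refine ih ?_
      have := hasProjectiveDimensionLT_of_subsingleton_ext (C := C) (d + m) X inferInstance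
        (by convert h using 1; omega) (hext _ (by omega))
      convert this using 1
      omega
  exact key n (hasProjectiveDimensionLT_of_ge _ (n + 1) _ (by omega))

/-- If all Ext groups `Extᵠ(X, C)` with `q > 2` vanish for finitely generated right modules, then
duals of finitely generated left modules are projective. -/
theorem projective_dual_of_ext_vanishing [IsNoetherianRing C] [IsNoetherianRing Cᵐᵒᵖ]
    (hgl : ∃ n : ℕ, globalDim C = n)
    (hext : ∀ (X : Type u) [AddCommGroup X] [Module Cᵐᵒᵖ X], Module.Finite Cᵐᵒᵖ X →
      ∀ q, 2 < q → Subsingleton (ExtTo Cᵐᵒᵖ C X q))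
    (V : Type u) [AddCommGroup V] [Module C V] [Module.Finite C V] :
    Module.Finite Cᵐᵒᵖ (V →ₗ[C] C) ∧ Module.Projective Cᵐᵒᵖ (V →ₗ[C] C) := by
  obtain ⟨n, π, hπ⟩ := Module.Finite.exists_fin' C V
  obtain ⟨m, σ, hσ⟩ := Module.Finite.exists_fin' C (LinearMap.ker π)
  have hfree : ∀ k : ℕ, Module.Finite Cᵐᵒᵖ ((Fin k → C) →ₗ[C] C) ∧
      Module.Projective Cᵐᵒᵖ ((Fin k → C) →ₗ[C] C) := fun k => by
    have : Module.Projective Cᵐᵒᵖ (Fin k → C) := Module.Projective.pi_const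
    exact ⟨Module.Finite.equiv ((Pi.basisFun C (Fin k)).constr Cᵐᵒᵖ),
      Module.Projective.of_equiv ((Pi.basisFun C (Fin k)).constr Cᵐᵒᵖ)⟩
  have := (hfree n).1
  have := (hfree m).1
  have hpn := (IsProjective.iff_projective ((Fin n → C) →ₗ[C] C)).1 (hfree n).2
  have hpm := (IsProjective.iff_projective ((Fin m → C) →ₗ[C] C)).1 (hfree m).2
  -- Dualising `C^m → C^n → V → 0` gives `0 → V* → (C^n)* → (C^m)*`, so `V*` is a second syzygy of
  -- the cokernel of `ρ`.
  let ρ : ((Fin n → C) →ₗ[C] C) →ₗ[Cᵐᵒᵖ] ((Fin m → C) →ₗ[C] C) :=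
    LinearMap.lcomp Cᵐᵒᵖ C ((LinearMap.ker π).subtype ∘ₗ σ)
  let p : (V →ₗ[C] C) →ₗ[Cᵐᵒᵖ] ((Fin n → C) →ₗ[C] C) := LinearMap.lcomp Cᵐᵒᵖ C π
  have hp : Function.Injective p := fun f g hfg => by
    ext x
    obtain ⟨x, rfl⟩ := hπ x
    exact LinearMap.congr_fun hfg x
  have hpρ : Function.Exact p ρ.rangeRestrict := fun f => by
    have hker : ρ.rangeRestrict f = 0 ↔ ∀ x ∈ LinearMap.ker π, f x = 0 := by
      rw [← Subtype.coe_inj]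
      constructor
      · intro h x hx
        obtain ⟨y, hy⟩ := hσ ⟨x, hx⟩
        have := LinearMap.congr_fun (show ρ f = 0 from h) y
        simpa [ρ, hy] using this
      · intro h
        change ρ f = 0
        ext y
        exact h _ (σ _).2
    rw [hker]
    constructor
    · intro h
      refine ⟨(LinearMap.ker π).liftQ f h ∘ₗ (π.quotKerEquivOfSurjective hπ).symm.toLinearMap, ?_⟩
      refine LinearMap.ext fun x => ?_
      have : (π.quotKerEquivOfSurjective hπ).symm (π x) = Submodule.Quotient.mk x := by
        rw [LinearEquiv.symm_apply_eq]
        rfl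
      simp only [p, LinearMap.lcomp_apply, LinearMap.comp_apply, LinearEquiv.coe_coe, this]
      rfl
    · rintro ⟨g, rfl⟩ x hx
      simp [p, LinearMap.mem_ker.1 hx]
  -- The bound 3 is strict: the cokernel has projective dimension at most 2, and each of the two
  -- syzygies lowers it by one.
  have hD : HasProjectiveDimensionLT
      (ModuleCat.of Cᵐᵒᵖ (((Fin m → C) →ₗ[C] C) ⧸ LinearMap.range ρ)) 3 :=
    hasProjectiveDimensionLT_of_ext_vanishing hgl (hext _ inferInstance)
  have hS₁ := (LinearMap.exact_subtype_mkQ (LinearMap.range ρ)).shortExact_moduleCat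
    (Submodule.subtype_injective _) (Submodule.mkQ_surjective _)
  have hI := (hS₁.hasProjectiveDimensionLT_X₃_iff 1 hpm).1 hD
  have hS₂ := Function.Exact.shortExact_moduleCat (Z := LinearMap.range ρ) hpρ hp ρ.surjective_rangeRestrict
  have hV := (hS₂.hasProjectiveDimensionLT_X₃_iff 0 hpn).1 hI
  exact ⟨Module.Finite.of_injective p hp, (IsProjective.iff_projective _).2
    (projective_iff_hasProjectiveDimensionLT_one.2 hV)⟩

end ProjectiveDimension

/-! ### Closed modules. -/

section Closed

variable {K : Type v} [CommRing K] {δ : DimFunction.{v, u} K} {n : EReal} {R : Type u} [Ring R]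
  [Algebra K R]

/-- `D` is closed if maps to `D` extend uniquely along almost isomorphisms between finitely
generated modules. -/
def IsClosedModule (δ : DimFunction.{v, u} K) (n : EReal) (R : Type u) [Ring R] [Algebra K R]
    (D : Type u) [AddCommGroup D] [Module R D] : Prop :=
  ∀ (X Y : Type u) [AddCommGroup X] [Module R X] [AddCommGroup Y] [Module R Y],
    Module.Finite R X → Module.Finite R Y → ∀ f : X →ₗ[R] Y, IsAlmostIso δ n f →
      ∀ g : X →ₗ[R] D, ∃! h : Y →ₗ[R] D, h ∘ₗ f = g

namespace IsClosedModule

variable {D D' : Type u} [AddCommGroup D] [Module R D] [AddCommGroup D'] [Module R D']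

/-- `Hom(ker f, D) = 0` lets `g` descend to the image of `f`; `Ext¹(coker f, D) = 0` extends it to
`Y`; `Hom(coker f, D) = 0` makes the extension unique. -/
theorem of_ext [IsNoetherianRing R]
    (h : ∀ (T : Type u) [AddCommGroup T] [Module R T], Module.Finite R T → δ R T ≤ n →
      Subsingleton (ExtTo R D T 0) ∧ Subsingleton (ExtTo R D T 1)) : IsClosedModule δ n R D := by
  intro X Y _ _ _ _ hX hY f hf g
  have hgker : LinearMap.ker f ≤ LinearMap.ker g := fun x hx => by
    have := extTo_zero_subsingleton_iff.1 (h (LinearMap.ker f) inferInstance hf.ker_le).1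
      (g ∘ₗ (LinearMap.ker f).subtype)
    exact LinearMap.congr_fun this ⟨x, hx⟩
  let e := f.quotKerEquivRange
  have he : ∀ x, e.symm (f.rangeRestrict x) = Submodule.Quotient.mk x := fun x => by
    rw [LinearEquiv.symm_apply_eq]
    rfl
  obtain ⟨k, hk⟩ := exists_comp_eq_of_subsingleton_ext
    (LinearMap.exact_subtype_mkQ (LinearMap.range f)) (Submodule.subtype_injective _)
    (Submodule.mkQ_surjective _) (h _ inferInstance hf.coker_le).2
    ((LinearMap.ker f).liftQ g hgker ∘ₗ e.symm.toLinearMap)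
  refine ⟨k, ?_, ?_⟩
  · ext x
    refine (LinearMap.congr_fun hk (f.rangeRestrict x)).trans ?_
    rw [LinearMap.comp_apply, LinearEquiv.coe_coe, he]
    rfl
  · intro k' hk'
    have hkf : k ∘ₗ f = g := by
      ext x
      refine (LinearMap.congr_fun hk (f.rangeRestrict x)).trans ?_
      rw [LinearMap.comp_apply, LinearEquiv.coe_coe, he]
      rfl
    have hr : LinearMap.range f ≤ LinearMap.ker (k' - k) := by
      rintro _ ⟨x, rfl⟩
      rw [LinearMap.mem_ker, LinearMap.sub_apply, sub_eq_zero]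
      exact LinearMap.congr_fun (hk'.trans hkf.symm) x
    have := extTo_zero_subsingleton_iff.1 (h _ inferInstance hf.coker_le).1
      ((LinearMap.range f).liftQ (k' - k) hr)
    ext y
    rw [← sub_eq_zero]
    exact LinearMap.congr_fun this (Submodule.Quotient.mk y)

theorem of_retract_pi (hD : IsClosedModule δ n R D) {k : ℕ} (i : D' →ₗ[R] (Fin k → D))
    (r : (Fin k → D) →ₗ[R] D') (hri : r ∘ₗ i = LinearMap.id) : IsClosedModule δ n R D' := by
  intro X Y _ _ _ _ hX hY f hf g
  choose h hh huniq using fun a => hD X Y hX hY f hf (LinearMap.proj a ∘ₗ i ∘ₗ g)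
  have hpi : LinearMap.pi h ∘ₗ f = i ∘ₗ g := by
    ext x a
    exact LinearMap.congr_fun (hh a) x
  refine ⟨r ∘ₗ LinearMap.pi h, ?_, fun h' hh' => ?_⟩
  · dsimp only
    rw [LinearMap.comp_assoc, hpi, ← LinearMap.comp_assoc, hri, LinearMap.id_comp]
  · have : i ∘ₗ h' = LinearMap.pi h := by
      ext y a
      refine LinearMap.congr_fun (huniq a (LinearMap.proj a ∘ₗ i ∘ₗ h') ?_) y
      dsimp only
      rw [← hh', LinearMap.comp_assoc, LinearMap.comp_assoc]
    rw [← this, ← LinearMap.comp_assoc, hri, LinearMap.id_comp]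

/-- Extending the identity of `D` along `f` gives a left inverse; it is also a right inverse, by
uniqueness of extensions into `D'`. -/
theorem bijective_of_isAlmostIso (hD : IsClosedModule δ n R D) (hD' : IsClosedModule δ n R D')
    [Module.Finite R D] [Module.Finite R D'] {f : D →ₗ[R] D'} (hf : IsAlmostIso δ n f) :
    Function.Bijective f := by
  obtain ⟨g, hg, -⟩ := hD D D' inferInstance inferInstance f hf LinearMap.id
  have hg' : f ∘ₗ g = LinearMap.id :=
    (hD' D D' inferInstance inferInstance f hf f).unique
      (by rw [LinearMap.comp_assoc, hg, LinearMap.comp_id])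
      (LinearMap.id_comp f)
  exact Function.bijective_iff_has_inverse.2
    ⟨g, LinearMap.congr_fun hg, LinearMap.congr_fun hg'⟩

end IsClosedModule

end Closed

/-! ### Consequences of the Cohen–Macaulay and Auslander conditions. -/

section CohenMacaulay

/-- A finite sum forces both terms to be finite, so the Cohen–Macaulay equation can be handled as
one between real numbers. -/
theorem EReal.exists_of_enat_add_eq {g : ℕ∞} {x : EReal} {d : ℕ} (hx : 0 ≤ x)
    (h : ((g : ENNReal) : EReal) + x = d) :
    ∃ (m : ℕ) (r : ℝ), g = m ∧ 0 ≤ r ∧ x = r ∧ (m : ℝ) + r = d := by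
  induction g using ENat.recTopCoe with
  | top =>
    rw [ENat.toENNReal_top, EReal.coe_ennreal_top, EReal.top_add_of_ne_bot] at h
    · exact absurd h (EReal.natCast_ne_top d).symm
    · rintro rfl
      simp at hx
  | coe m =>
    induction x with
    | bot => simp at hx
    | top =>
      rw [EReal.add_top_of_ne_bot (by simp)] at h
      exact absurd h (EReal.natCast_ne_top d).symm
    | coe r =>
      refine ⟨m, r, rfl, by exact_mod_cast hx, rfl, ?_⟩
      have hm : (((m : ℕ∞) : ENNReal) : EReal) = ((m : ℝ) : EReal) := by
        rw [ENat.toENNReal_coe]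
        rfl
      rw [hm, ← EReal.coe_add, show (d : EReal) = ((d : ℝ) : EReal) from rfl, EReal.coe_eq_coe_iff] at h
      exact h

variable {K : Type v} [CommRing K] {δ : DimFunction.{v, u} K} {C : Type u} [Ring C] [Algebra K C]

namespace IsDimCM

variable {X : Type u} [AddCommGroup X]

theorem exists_grade_right (hCM : IsDimCM δ C) (hδ : IsExactDimension δ Cᵐᵒᵖ) {d : ℕ}
    (hd : δ.alg C = d) [Module Cᵐᵒᵖ X] [Module.Finite Cᵐᵒᵖ X] [Nontrivial X] :
    ∃ (m : ℕ) (r : ℝ), gradeNumber Cᵐᵒᵖ C X = m ∧ 0 ≤ r ∧ δ Cᵐᵒᵖ X = r ∧ (m : ℝ) + r = d := by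
  refine EReal.exists_of_enat_add_eq ((hδ.eq_bot_or_nonneg X).resolve_left fun h => ?_)
    ((hCM.2.1 X inferInstance inferInstance).trans hd)
  exact not_subsingleton X ((hδ.eq_bot_iff X).1 h)

theorem exists_grade_left (hCM : IsDimCM δ C) (hδ : IsExactDimension δ C) {d : ℕ}
    (hd : δ.alg C = d) [Module C X] [Module.Finite C X] [Nontrivial X] :
    ∃ (m : ℕ) (r : ℝ), gradeNumber C C X = m ∧ 0 ≤ r ∧ δ C X = r ∧ (m : ℝ) + r = d := by
  refine EReal.exists_of_enat_add_eq ((hδ.eq_bot_or_nonneg X).resolve_left fun h => ?_)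
    ((hCM.2.2 X inferInstance inferInstance).trans hd)
  exact not_subsingleton X ((hδ.eq_bot_iff X).1 h)

theorem two_le_gradeNumber (hCM : IsDimCM δ C) (hδ : IsExactDimension δ Cᵐᵒᵖ) [Module Cᵐᵒᵖ X]
    [Module.Finite Cᵐᵒᵖ X] (hX : δ Cᵐᵒᵖ X ≤ δ.alg C - 2) :
    ((2 : ℕ) : ℕ∞) ≤ gradeNumber Cᵐᵒᵖ C X := by
  obtain ⟨d, hd⟩ := hCM.1
  rcases subsingleton_or_nontrivial X with h | h
  -- The zero module has grade `∞`; the Cohen–Macaulay equation says nothing about it.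
  · refine le_gradeNumber_iff.2 fun i _ => subsingleton_of_forall_eq 0 fun e => ?_
    have hz : Limits.IsZero (ModuleCat.of Cᵐᵒᵖ X) := ModuleCat.isZero_of_subsingleton _
    have := hz.hasProjectiveDimensionLT_zero
    exact Abelian.Ext.eq_zero_of_hasProjectiveDimensionLT e 0 (Nat.zero_le i)
  · obtain ⟨m, r, hm, -, hr, hmr⟩ := hCM.exists_grade_right hδ hd (X := X)
    rw [hm]
    rw [hr, hd] at hX
    have h2 : r ≤ d - 2 := EReal.coe_le_coe_iff.1 hX
    have : (2 : ℝ) ≤ m := by linarith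
    exact_mod_cast this

theorem dim_le_of_two_le_gradeNumber (hCM : IsDimCM δ C) (hδ : IsExactDimension δ Cᵐᵒᵖ)
    [Module Cᵐᵒᵖ X] [Module.Finite Cᵐᵒᵖ X]
    (hX : ((2 : ℕ) : ℕ∞) ≤ gradeNumber Cᵐᵒᵖ C X) : δ Cᵐᵒᵖ X ≤ δ.alg C - 2 := by
  obtain ⟨d, hd⟩ := hCM.1
  rcases subsingleton_or_nontrivial X with h | h
  · exact hδ.le_of_subsingleton
  · obtain ⟨m, r, hm, -, hr, hmr⟩ := hCM.exists_grade_right hδ hd (X := X)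
    rw [hm] at hX
    have h2 : (2 : ℝ) ≤ m := by exact_mod_cast hX
    rw [hr, hd]
    have : r ≤ d - 2 := by linarith
    exact EReal.coe_le_coe_iff.2 this

/-- Over a Cohen–Macaulay algebra `C`, the right module `C` is closed. -/
theorem isClosedModule_self [IsNoetherianRing Cᵐᵒᵖ] (hCM : IsDimCM δ C)
    (hδ : IsExactDimension δ Cᵐᵒᵖ) : IsClosedModule δ (δ.alg C - 2) Cᵐᵒᵖ C :=
  IsClosedModule.of_ext fun _ _ _ _ hT =>
    ⟨le_gradeNumber_iff.1 (hCM.two_le_gradeNumber hδ hT) 0 (by norm_num),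
      le_gradeNumber_iff.1 (hCM.two_le_gradeNumber hδ hT) 1 (by norm_num)⟩

theorem isClosedModule_of_projective [IsNoetherianRing Cᵐᵒᵖ] (hCM : IsDimCM δ C)
    (hδ : IsExactDimension δ Cᵐᵒᵖ) [Module Cᵐᵒᵖ X] [Module.Finite Cᵐᵒᵖ X]
    [Module.Projective Cᵐᵒᵖ X] : IsClosedModule δ (δ.alg C - 2) Cᵐᵒᵖ X := by
  obtain ⟨k, i, r, hri⟩ := exists_retract_pi (P := X) (opLinearEquivSelf C)
  exact (hCM.isClosedModule_self hδ).of_retract_pi i r hri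

/-- A nonzero class would span a cyclic left module of grade at least `q` by the Auslander
condition, while grade plus dimension equals `d < q`. Passing to a cyclic submodule avoids asking
whether the Ext group is finitely generated. -/
theorem ext_vanishing (hCM : IsDimCM δ C) (hAR : AuslanderCondition Cᵐᵒᵖ C C)
    (hδ : IsExactDimension δ C) {d : ℕ} (hd : δ.alg C = d) [Module Cᵐᵒᵖ X] [Module.Finite Cᵐᵒᵖ X]
    {q : ℕ} (hq : d < q) : Subsingleton (ExtTo Cᵐᵒᵖ C X q) := by
  refine subsingleton_of_forall_eq 0 fun e => ?_
  by_contra he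
  have : Nontrivial (Submodule.span C {e}) :=
    Submodule.nontrivial_span_singleton he
  obtain ⟨m, r, hm, hr, -, hmr⟩ := hCM.exists_grade_left hδ hd (X := Submodule.span C {e})
  have hle := hAR X inferInstance q (Submodule.span C {e})
  rw [hm] at hle
  have h₁ : (q : ℝ) ≤ m := by exact_mod_cast hle
  have h₂ : (d : ℝ) < q := by exact_mod_cast hq
  linarith

/-- The bound 2 on the dimension is used here: it matches the two steps by which a dual is a syzygy.
-/
theorem projective_dual [IsNoetherianRing C] [IsNoetherianRing Cᵐᵒᵖ] (hCM : IsDimCM δ C)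
    (hAR : IsAuslanderRegular C) (hδ : IsExactDimension δ C) (hd : δ.alg C ≤ 2)
    (V : Type u) [AddCommGroup V] [Module C V] [Module.Finite C V] :
    Module.Finite Cᵐᵒᵖ (V →ₗ[C] C) ∧ Module.Projective Cᵐᵒᵖ (V →ₗ[C] C) := by
  obtain ⟨d, hd'⟩ := hCM.1
  have hd2 : d ≤ 2 := by
    rw [hd'] at hd
    exact_mod_cast hd
  exact projective_dual_of_ext_vanishing hAR.1 (fun X _ _ _ q hq =>
    hCM.ext_vanishing hAR.2.1 hδ hd' (hd2.trans_lt hq)) V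

end IsDimCM

end CohenMacaulay

/-! ### The double dual and the cokernel of evaluation. -/

section DoubleDual

variable (C : Type u) [Ring C] (M : Type u) [AddCommGroup M] [Module Cᵐᵒᵖ M]

/-- The double dual of a right `C`-module, a right `C`-module. -/
abbrev DoubleDual : Type u := (M →ₗ[Cᵐᵒᵖ] C) →ₗ[C] C

/-- The canonical map to the double dual. -/
def doubleDualEval : M →ₗ[Cᵐᵒᵖ] DoubleDual C M where
  toFun m := { toFun := fun f => f m, map_add' := fun _ _ => rfl, map_smul' := fun _ _ => rfl }
  map_add' m m' := by ext f; exact map_add f m m'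
  map_smul' c m := by ext f; exact map_smul f c m

variable {C M}

@[simp]
theorem doubleDualEval_apply (m : M) (f : M →ₗ[Cᵐᵒᵖ] C) : doubleDualEval C M m f = f m := rfl

/-- The coordinates of a functional on the images of the standard generators. -/
def dualCoord {k : ℕ} (π : (Fin k → Cᵐᵒᵖ) →ₗ[Cᵐᵒᵖ] M) : (M →ₗ[Cᵐᵒᵖ] C) →ₗ[C] (Fin k → C) where
  toFun f i := f (π (Pi.single i 1))
  map_add' _ _ := rfl
  map_smul' _ _ := rfl

theorem dualCoord_injective {k : ℕ} {π : (Fin k → Cᵐᵒᵖ) →ₗ[Cᵐᵒᵖ] M} (hπ : Function.Surjective π) :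
    Function.Injective (dualCoord π) := by
  intro f g h
  have : f ∘ₗ π = g ∘ₗ π := by
    refine LinearMap.pi_ext' fun i => LinearMap.ext_ring ?_
    exact congrFun h i
  ext x
  obtain ⟨x, rfl⟩ := hπ x
  exact LinearMap.congr_fun this x

instance [IsNoetherianRing C] [Module.Finite Cᵐᵒᵖ M] : Module.Finite C (M →ₗ[Cᵐᵒᵖ] C) := by
  obtain ⟨k, π, hπ⟩ := Module.Finite.exists_fin' Cᵐᵒᵖ M
  exact Module.Finite.of_injective _ (dualCoord_injective hπ)

/-- Under the Auslander condition, a functional on the double dual vanishing on `M` is zero. -/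
theorem eq_zero_of_comp_doubleDualEval (hAR : AuslanderCondition C Cᵐᵒᵖ C) [Module.Finite Cᵐᵒᵖ M]
    (g : DoubleDual C M →ₗ[Cᵐᵒᵖ] C) (hg : g ∘ₗ doubleDualEval C M = 0) : g = 0 := by
  obtain ⟨k, π, hπ⟩ := Module.Finite.exists_fin' Cᵐᵒᵖ M
  -- Dualising `0 → M* → C^k → V → 0` sends `M**` to `Ext¹(V, C)` by the connecting map `φ`. The
  -- plan is to show that `ker φ` comes from `M`, so that `g` factors through a submodule of
  -- `Ext¹(V, C)`.
  have hex : Function.Exact (dualCoord π) (LinearMap.range (dualCoord π)).mkQ :=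
    LinearMap.exact_map_mkQ_range _
  let E := (hex.shortExact_moduleCat (dualCoord_injective hπ) (Submodule.mkQ_surjective _)).extClass
  let φ : DoubleDual C M →ₗ[Cᵐᵒᵖ]
      ExtTo C C ((Fin k → C) ⧸ LinearMap.range (dualCoord π)) 1 :=
    { toFun := fun x => E.comp (Abelian.Ext.mk₀ (ModuleCat.ofHom x)) (add_zero 1)
      map_add' := fun x y => by
        rw [← Abelian.Ext.comp_add, ← Abelian.Ext.mk₀_add]
        rfl
      map_smul' := fun c x => by
        change _ = (E.comp (Abelian.Ext.mk₀ (ModuleCat.ofHom x)) (add_zero 1)).comp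
          (Abelian.Ext.mk₀ (ModuleCat.ofHom (Module.toModuleEnd C (S := Cᵐᵒᵖ) C c))) (add_zero 1)
        rw [Abelian.Ext.comp_assoc_of_third_deg_zero, Abelian.Ext.mk₀_comp_mk₀]
        rfl }
  have hφ : LinearMap.ker φ ≤ LinearMap.ker g := fun x hx => by
    obtain ⟨y, hy⟩ := exists_comp_eq_of_extClass_comp_eq_zero hex (dualCoord_injective hπ)
      (Submodule.mkQ_surjective _) x hx
    -- If `x` extends to a functional `y` on `C^k`, the values of `y` on the standard basis are
    -- coefficients of an element of `M` at which `x` is evaluation.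
    have hx' : x = doubleDualEval C M
        (∑ i, op (y (Pi.single i 1)) • π (Pi.single i (1 : Cᵐᵒᵖ))) := by
      ext f
      rw [← hy]
      have : dualCoord π f = ∑ i, f (π (Pi.single i 1)) • Pi.single i (1 : C) := by
        ext j
        simp [dualCoord, Finset.sum_apply, Pi.single_apply]
      rw [LinearMap.comp_apply, this, map_sum, doubleDualEval_apply, map_sum]
      refine Finset.sum_congr rfl fun i _ => ?_
      rw [map_smul, map_smul]
      rfl
    rw [hx', LinearMap.mem_ker]
    exact LinearMap.congr_fun hg _
  have hgrade := hAR ((Fin k → C) ⧸ LinearMap.range (dualCoord π)) inferInstance 1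
    (LinearMap.range φ)
  -- The image of `φ` has grade at least 1 and so admits no nonzero map to `C`.
  have hzero := extTo_zero_subsingleton_iff.1 (le_gradeNumber_iff.1 hgrade 0 zero_lt_one)
    ((LinearMap.ker φ).liftQ g hφ ∘ₗ φ.quotKerEquivRange.symm.toLinearMap)
  ext x
  have := LinearMap.congr_fun hzero (φ.rangeRestrict x)
  have he : φ.quotKerEquivRange.symm (φ.rangeRestrict x) = Submodule.Quotient.mk x := by
    rw [LinearEquiv.symm_apply_eq]
    rfl
  rw [LinearMap.comp_apply, LinearEquiv.coe_coe, he] at this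
  exact this

variable {K : Type v} [CommRing K] {δ : DimFunction.{v, u} K} [Algebra K C]

/-- By the Cohen–Macaulay equation it is enough that the cokernel has grade at least 2. Its Hom into
`C` vanishes by `eq_zero_of_comp_doubleDualEval`; its Ext¹ vanishes because the double dual is
projective and functionals on the image of `M` extend to it. -/
theorem IsDimCM.doubleDualEval_coker_le [IsNoetherianRing C] [IsNoetherianRing Cᵐᵒᵖ]
    (hCM : IsDimCM δ C) (hAR : IsAuslanderRegular C) (hδ : IsExactDimension δ C)
    (hδ' : IsExactDimension δ Cᵐᵒᵖ) (hd : δ.alg C ≤ 2) [Module.Finite Cᵐᵒᵖ M] :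
    δ Cᵐᵒᵖ (DoubleDual C M ⧸ LinearMap.range (doubleDualEval C M)) ≤ δ.alg C - 2 := by
  obtain ⟨hfin, hproj⟩ := hCM.projective_dual hAR hδ hd (M →ₗ[Cᵐᵒᵖ] C)
  refine hCM.dim_le_of_two_le_gradeNumber hδ' (le_gradeNumber_iff.2 fun i hi => ?_)
  interval_cases i
  · refine extTo_zero_subsingleton_iff.2 fun f => ?_
    have h := eq_zero_of_comp_doubleDualEval hAR.2.2
      (f ∘ₗ (LinearMap.range (doubleDualEval C M)).mkQ) (by
        rw [LinearMap.comp_assoc, LinearMap.range_mkQ_comp, LinearMap.comp_zero])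
    ext y
    exact LinearMap.congr_fun h y
  · refine subsingleton_ext_one_of_projective
      (LinearMap.exact_subtype_mkQ (LinearMap.range (doubleDualEval C M)))
      (Submodule.subtype_injective _) (Submodule.mkQ_surjective _) fun k => ?_
    -- A functional on the image of `M` pulls back to an element of `M*`, and evaluating `M**` at
    -- that element extends it.
    refine ⟨{ toFun := fun x => x (k ∘ₗ (doubleDualEval C M).rangeRestrict)
              map_add' := fun _ _ => rfl
              map_smul' := fun _ _ => rfl }, ?_⟩
    ext ⟨_, m, rfl⟩
    rfl

end DoubleDual

/-! ### Left actions and projectivity of tensor products. -/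

namespace BalancedTensor

section Left

variable {A : Type u} [Ring A] {M N : Type u} [AddCommGroup M] [Module Aᵐᵒᵖ M] [AddCommGroup N]
  [Module A N] {S : Type*} [Ring S] [Module S M] [SMulCommClass S Aᵐᵒᵖ M]

/-- An additive map out of `M ⊗_A N` which is `S`-linear on pure tensors, for `S` acting on `M`. -/
theorem map_smul_of_left {G : Type*} [AddCommGroup G] [Module S G] (φ : BalancedTensor A M N →+ G)
    (hφ : ∀ (s : S) x y, φ (tmul A (s • x) y) = s • φ (tmul A x y)) (s : S)
    (t : BalancedTensor A M N) : φ (s • t) = s • φ t := by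
  refine induction A (p := fun t => φ (s • t) = s • φ t) ?_ (hφ s) ?_ t
  · simp
  · intro t t' h h'
    rw [smul_add, map_add, map_add, h, h', smul_add]

/-- The map `M ⊗_A f` as an `S`-linear map, for `S` acting on `M`. -/
noncomputable def lTensor (S : Type*) [Ring S] (M : Type u) [AddCommGroup M] [Module Aᵐᵒᵖ M]
    [Module S M] [SMulCommClass S Aᵐᵒᵖ M] {N' : Type u} [AddCommGroup N'] [Module A N']
    (f : N →ₗ[A] N') : BalancedTensor A M N →ₗ[S] BalancedTensor A M N' where
  toFun := map A LinearMap.id f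
  map_add' := map_add _
  map_smul' := map_smul_of_left (map A LinearMap.id f) fun _ _ _ => rfl

/-- `- ⊗ y` as an `S`-linear map. -/
noncomputable def mkLeft (S : Type*) [Ring S] [Module S M] [SMulCommClass S Aᵐᵒᵖ M] (y : N) :
    M →ₗ[S] BalancedTensor A M N where
  toFun x := tmul A x y
  map_add' x x' := add_tmul A x x' y
  map_smul' _ _ := rfl

theorem finite_left [Module.Finite S M] [Module.Finite A N] :
    Module.Finite S (BalancedTensor A M N) := by
  classical
  obtain ⟨s, hs⟩ := Module.Finite.fg_top (R := A) (M := N)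
  have : Module.Finite S ((i : s) → M) := inferInstance
  refine Module.Finite.of_surjective
    (LinearMap.lsum S (fun _ : s => M) ℕ fun y => mkLeft (A := A) S (y : N)) ?_
  intro t
  refine induction A (p := fun t => t ∈ LinearMap.range
      (LinearMap.lsum S (fun _ : s => M) ℕ fun y => mkLeft (A := A) S (y : N)))
    (Submodule.zero_mem _) ?_ (fun _ _ => Submodule.add_mem _) t
  intro x y
  have hy : y ∈ Submodule.span A (s : Set N) := hs ▸ Submodule.mem_top
  induction hy using Submodule.span_induction generalizing x with
  | mem y hy =>
    refine ⟨Pi.single ⟨y, hy⟩ x, ?_⟩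
    rw [LinearMap.lsum_piSingle]
    rfl
  | zero => rw [tmul_zero]; exact Submodule.zero_mem _
  | add y y' _ _ h h' => rw [tmul_add]; exact Submodule.add_mem _ (h x) (h' x)
  | smul a y _ h => rw [← smul_tmul]; exact h _

end Left

section Bimodule

variable {A B M N L S : Type u} [Ring A] [Ring B] [Ring S] [AddCommGroup M] [Module Aᵐᵒᵖ M]
  [AddCommGroup N] [Module A N] [AddCommGroup L] [Module B L] [Module Bᵐᵒᵖ N]
  [SMulCommClass Bᵐᵒᵖ A N] [SMulCommClass A Bᵐᵒᵖ N]

theorem assocHom_smul_right [Module S L] [SMulCommClass S B L] (s : S)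
    (t : BalancedTensor A M N) (l : L) :
    assocHom A B M N L (tmul B t (s • l)) = s • assocHom A B M N L (tmul B t l) := by
  refine induction A (p := fun t => assocHom A B M N L (tmul B t (s • l)) =
    s • assocHom A B M N L (tmul B t l)) ?_ (fun _ _ => rfl) ?_ t
  · rw [zero_tmul, zero_tmul, map_zero, smul_zero]
  · intro t t' h h'
    rw [add_tmul, add_tmul, map_add, map_add, smul_add, h, h']

theorem assocHom_smul_left [Module S M] [SMulCommClass S Aᵐᵒᵖ M] (s : S)
    (t : BalancedTensor B (BalancedTensor A M N) L) :
    assocHom A B M N L (s • t) = s • assocHom A B M N L t := by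
  refine map_smul_of_left (assocHom A B M N L) (fun s t l => ?_) s t
  refine induction A (p := fun t => assocHom A B M N L (tmul B (s • t) l) =
    s • assocHom A B M N L (tmul B t l)) ?_ (fun _ _ => rfl) ?_ t
  · rw [smul_zero, zero_tmul, map_zero, smul_zero]
  · intro t t' h h'
    rw [smul_add, add_tmul, add_tmul, map_add, map_add, smul_add, h, h']

theorem lidHom_smul_left (s : A) (t : BalancedTensor A A N) :
    lidHom A N (s • t) = s • lidHom A N t :=
  map_smul_of_left (lidHom A N) (fun a b y => mul_smul a b y) s t

theorem ridHom_smul_left [Module S M] [SMulCommClass S Aᵐᵒᵖ M] (s : S)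
    (t : BalancedTensor A M A) : ridHom A M (s • t) = s • ridHom A M t :=
  map_smul_of_left (ridHom A M) (fun s x a => (smul_comm s (op a) x).symm) s t

end Bimodule

/-- The tensor product of a projective right `A`-module with a bimodule which is projective on the
right is projective. -/
theorem projective_right {A S : Type u} [Ring A] [Ring S] {P Q : Type u} [AddCommGroup P]
    [Module Aᵐᵒᵖ P] [AddCommGroup Q] [Module A Q] [Module S Q] [SMulCommClass S A Q]
    [Module.Finite Aᵐᵒᵖ P] [Module.Projective Aᵐᵒᵖ P] [Module.Projective S Q] :
    Module.Projective S (BalancedTensor A P Q) := by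
  obtain ⟨k, i, r, hri⟩ := exists_retract_pi (P := P) (LinearEquiv.refl Aᵐᵒᵖ Aᵐᵒᵖ)
  have : Module.Projective S (Fin k → Q) := Module.Projective.pi_const
  let e := LinearEquiv.ofBijective (piCoord A S Q (Fin k)) ⟨piCoord_injective _, fun y => by
    classical
    refine ⟨∑ j, tmul A (Pi.single j (1 : Aᵐᵒᵖ) : Fin k → Aᵐᵒᵖ) (y j), ?_⟩
    ext i
    simp only [map_sum, Finset.sum_apply, piCoord_tmul]
    rw [Finset.sum_eq_single i]
    · simp
    · intro j _ hj
      simp [hj.symm]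
    · simp⟩
  have : Module.Projective S (BalancedTensor A (Fin k → Aᵐᵒᵖ) Q) :=
    Module.Projective.of_equiv e.symm
  refine Module.Projective.of_split (rTensor S Q i) (rTensor S Q r) ?_
  rw [← rTensor_comp, hri]
  exact linearMap_ext fun _ _ => rfl

end BalancedTensor

open BalancedTensor

/-! ### Homomorphisms of bimodules, associativity and units. -/

namespace CentralBimodule

variable {K : Type v} [CommRing K] {A B C D : Type u} [Ring A] [Algebra K A] [Ring B] [Algebra K B]
  [Ring C] [Algebra K C] [Ring D] [Algebra K D]

/-- Homomorphisms of bimodules. -/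
structure Hom (X Y : CentralBimodule K A B) where
  /-- The underlying right linear map. -/
  toLin : X →ₗ[Bᵐᵒᵖ] Y
  map_left : ∀ (a : A) (x : X), toLin (a • x) = a • toLin x

namespace Hom

variable {X Y Z : CentralBimodule K A B}

/-- The identity. -/
def id (X : CentralBimodule K A B) : Hom X X := ⟨LinearMap.id, fun _ _ => rfl⟩

/-- Composition of bimodule homomorphisms. -/
def comp (g : Hom Y Z) (f : Hom X Y) : Hom X Z :=
  ⟨g.toLin ∘ₗ f.toLin, fun a x => by
    rw [LinearMap.comp_apply, f.map_left, g.map_left, LinearMap.comp_apply]⟩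

/-- The inverse of a bijective homomorphism of bimodules. -/
noncomputable def inv (f : Hom X Y) (hf : Function.Bijective f.toLin) : Hom Y X :=
  ⟨(LinearEquiv.ofBijective f.toLin hf).symm.toLinearMap, fun a y => by
    have h : ∀ y, f.toLin ((LinearEquiv.ofBijective f.toLin hf).symm y) = y :=
      (LinearEquiv.ofBijective f.toLin hf).apply_symm_apply
    refine hf.1 ?_
    rw [f.map_left, LinearEquiv.coe_coe, h, h]⟩

theorem inv_bijective (f : Hom X Y) (hf : Function.Bijective f.toLin) :
    Function.Bijective (f.inv hf).toLin :=
  (LinearEquiv.ofBijective f.toLin hf).symm.bijective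

/-- The map `f ⊗_B N`. -/
noncomputable def rTensor (f : Hom X Y) (N : CentralBimodule K B C) :
    Hom (X.tensor N) (Y.tensor N) where
  toLin := BalancedTensor.rTensor Cᵐᵒᵖ N f.toLin
  map_left := map_smul_of_left (BalancedTensor.rTensor Cᵐᵒᵖ N f.toLin).toAddMonoidHom fun a x y =>
    congrArg (fun z => tmul B z y) (f.map_left a x)

/-- The map `M ⊗_A f`. -/
noncomputable def lTensor (M : CentralBimodule K C A) (f : Hom X Y) :
    Hom (M.tensor X) (M.tensor Y) where
  toLin := BalancedTensor.mapRight LinearMap.id f.toLin f.map_left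
  map_left := map_smul_of_left
    (BalancedTensor.mapRight LinearMap.id f.toLin f.map_left).toAddMonoidHom fun _ _ _ => rfl

/-- The associativity isomorphism. -/
noncomputable def assoc (M : CentralBimodule K A B) (N : CentralBimodule K B C)
    (L : CentralBimodule K C D) : Hom ((M.tensor N).tensor L) (M.tensor (N.tensor L)) where
  toLin := linearOfRight (S := Dᵐᵒᵖ) (assocHom B C M N L) assocHom_smul_right
  map_left := assocHom_smul_left

theorem assoc_bijective (M : CentralBimodule K A B) (N : CentralBimodule K B C)
    (L : CentralBimodule K C D) : Function.Bijective (assoc M N L).toLin :=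
  assocHom_bijective (A := B) (B := C) (M := M) (N := N) (L := L)

/-- The isomorphism `A ⊗_A N → N`. -/
noncomputable def lid (N : CentralBimodule K A B) : Hom ((regular K A).tensor N) N where
  toLin := linearOfRight (S := Bᵐᵒᵖ) (lidHom A N) fun s a y => smul_comm (M := A) (N := Bᵐᵒᵖ) (α := N) a s y
  map_left := lidHom_smul_left (A := A) (N := N)

theorem lid_bijective (N : CentralBimodule K A B) : Function.Bijective (lid N).toLin :=
  lidHom_bijective (A := A) (N := N)

/-- The isomorphism `M ⊗_B B → M`. -/
noncomputable def rid (M : CentralBimodule K A B) : Hom (M.tensor (regular K B)) M where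
  toLin := linearOfRight (S := Bᵐᵒᵖ) (ridHom B M) fun s x b => mul_smul s (op b) x
  map_left := ridHom_smul_left (A := B) (M := M) (S := A)

theorem rid_bijective (M : CentralBimodule K A B) : Function.Bijective (rid M).toLin :=
  ridHom_bijective (A := B) (M := M)

end Hom

theorem finite_tensor (M : CentralBimodule K A B) (N : CentralBimodule K B C)
    (hM : Module.Finite Bᵐᵒᵖ M) (hN : Module.Finite Cᵐᵒᵖ N) : Module.Finite Cᵐᵒᵖ (M.tensor N) :=
  finite_right (A := B) (M := M) (N := N) (S := Cᵐᵒᵖ)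

theorem IsFG.tensor {M : CentralBimodule K A B} {N : CentralBimodule K B C} (hM : M.IsFG)
    (hN : N.IsFG) : (M.tensor N).IsFG :=
  ⟨by
    have := hM.1
    have := hN.1
    exact finite_left (A := B) (M := M) (N := N) (S := A), finite_tensor M N hM.2 hN.2⟩

/-- A right submodule stable under the left action, as a bimodule. -/
def ofSubmodule (M : CentralBimodule K A B) (S : Submodule Bᵐᵒᵖ M)
    (hS : ∀ (a : A), ∀ x ∈ S, a • x ∈ S) : CentralBimodule K A B :=
  letI : Module A S :=
    { smul := fun a x => ⟨a • x.1, hS a x.1 x.2⟩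
      one_smul := fun x => Subtype.ext (one_smul A x.1)
      mul_smul := fun a b x => Subtype.ext (mul_smul a b x.1)
      smul_zero := fun a => Subtype.ext (smul_zero a)
      smul_add := fun a x y => Subtype.ext (smul_add a x.1 y.1)
      add_smul := fun a b x => Subtype.ext (add_smul a b x.1)
      zero_smul := fun x => Subtype.ext (zero_smul A x.1) }
  { carrier := S
    smulComm := ⟨fun a b x => Subtype.ext (smul_comm a b x.1)⟩
    towerLeft := ⟨fun k a x => Subtype.ext (smul_assoc k a x.1)⟩
    towerRight := ⟨fun k b x => Subtype.ext (smul_assoc k b x.1)⟩ }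

/-- The inclusion of a sub-bimodule. -/
def ofSubmoduleSubtype (M : CentralBimodule K A B) (S : Submodule Bᵐᵒᵖ M)
    (hS : ∀ (a : A), ∀ x ∈ S, a • x ∈ S) : Hom (M.ofSubmodule S hS) M :=
  ⟨S.subtype, fun _ _ => rfl⟩

theorem ofSubmodule_isFG [IsNoetherianRing A] [IsNoetherianRing Bᵐᵒᵖ] {M : CentralBimodule K A B}
    (hM : M.IsFG) (S : Submodule Bᵐᵒᵖ M) (hS : ∀ (a : A), ∀ x ∈ S, a • x ∈ S) :
    (M.ofSubmodule S hS).IsFG := by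
  have := hM.1
  have := hM.2
  constructor
  · exact Module.Finite.of_injective
      ({ (M.ofSubmoduleSubtype S hS).toLin with map_smul' := (M.ofSubmoduleSubtype S hS).map_left } :
        M.ofSubmodule S hS →ₗ[A] M) Subtype.val_injective
  · exact inferInstanceAs (Module.Finite Bᵐᵒᵖ S)

/-! ### Morita equivalence from a pair of inverse bimodules. -/

section Morita

variable {P : CentralBimodule K B C} {Q : CentralBimodule K C B}

/-- The map `P ⊗_C (Q ⊗_B X) → X` induced by `k : P ⊗_C Q → B`. -/
noncomputable def pairingHom (k : BalancedTensor C P Q →ₗ[Bᵐᵒᵖ] B) (X : Type u) [AddCommGroup X]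
    [Module B X] : BalancedTensor C P (BalancedTensor B Q X) →+ X :=
  ((lidHom B X).comp (BalancedTensor.map B k (LinearMap.id : X →ₗ[B] X))).comp (assocInv C B P Q X)

theorem pairingHom_tmul (k : BalancedTensor C P Q →ₗ[Bᵐᵒᵖ] B) (X : Type u) [AddCommGroup X]
    [Module B X] (p : P) (q : Q) (x : X) :
    pairingHom k X (tmul C p (tmul B q x)) = k (tmul C p q) • x := rfl

theorem pairingHom_smul {k : BalancedTensor C P Q →ₗ[Bᵐᵒᵖ] B} (hk : ∀ (b : B) t, k (b • t) = b • k t)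
    (X : Type u) [AddCommGroup X] [Module B X] (b : B)
    (t : BalancedTensor C P (BalancedTensor B Q X)) :
    pairingHom k X (b • t) = b • pairingHom k X t := by
  refine map_smul_of_left (pairingHom k X) (fun b p t => ?_) b t
  refine BalancedTensor.induction B (p := fun t => pairingHom k X (tmul C (b • p) t) =
    b • pairingHom k X (tmul C p t)) ?_ ?_ ?_ t
  · rw [tmul_zero, tmul_zero, map_zero, smul_zero]
  · intro q x
    rw [pairingHom_tmul, pairingHom_tmul, ← mul_smul]
    exact congrArg (fun z : B => z • x) (hk b (tmul C p q))
  · intro t t' h h'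
    rw [tmul_add, tmul_add, map_add, map_add, smul_add, h, h']

theorem pairingHom_naturality (k : BalancedTensor C P Q →ₗ[Bᵐᵒᵖ] B) {X Y : Type u} [AddCommGroup X]
    [Module B X] [AddCommGroup Y] [Module B Y] (f : X →ₗ[B] Y)
    (t : BalancedTensor C P (BalancedTensor B Q X)) :
    pairingHom k Y (BalancedTensor.lTensor B P (BalancedTensor.lTensor C Q f) t) =
      f (pairingHom k X t) := by
  refine induction₃' (p := fun t => pairingHom k Y
    (BalancedTensor.lTensor B P (BalancedTensor.lTensor C Q f) t) = f (pairingHom k X t)) ?_ ?_ ?_ t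
  · simp only [map_zero]
  · intro p q x
    rw [pairingHom_tmul, map_smul]
    rfl
  · intro t t' h h'
    simp only [map_add, h, h']

theorem pairingHom_bijective {k : BalancedTensor C P Q →ₗ[Bᵐᵒᵖ] B} (hk : Function.Bijective k)
    (X : Type u) [AddCommGroup X] [Module B X] : Function.Bijective (pairingHom k X) := by
  have hmap : Function.Bijective (BalancedTensor.map B k (LinearMap.id : X →ₗ[B] X)) := by
    let e := LinearEquiv.ofBijective k hk
    refine Function.bijective_iff_has_inverse.2
      ⟨BalancedTensor.map B e.symm.toLinearMap LinearMap.id, fun t => ?_, fun t => ?_⟩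
    · change (BalancedTensor.map B e.symm.toLinearMap LinearMap.id)
        (BalancedTensor.map B e.toLinearMap LinearMap.id t) = t
      rw [← AddMonoidHom.comp_apply, ← BalancedTensor.map_comp, LinearEquiv.symm_comp]
      exact DFunLike.congr_fun (BalancedTensor.map_id B) t
    · change (BalancedTensor.map B e.toLinearMap LinearMap.id)
        (BalancedTensor.map B e.symm.toLinearMap LinearMap.id t) = t
      rw [← AddMonoidHom.comp_apply, ← BalancedTensor.map_comp, LinearEquiv.comp_symm]
      exact DFunLike.congr_fun (BalancedTensor.map_id B) t
  exact (lidHom_bijective.comp hmap).comp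
    (Function.bijective_iff_has_inverse.2 ⟨_, assocHom_assocInv, assocInv_assocHom⟩)

/-- An isomorphism `P ⊗_C Q → B` of bimodules makes `P ⊗_C (Q ⊗_B -)` isomorphic to the identity. -/
noncomputable def pairingIso (k : BalancedTensor C P Q →ₗ[Bᵐᵒᵖ] B)
    (hk : ∀ (b : B) t, k (b • t) = b • k t) (hk' : Function.Bijective k) :
    tensorLeft Q ⋙ tensorLeft P ≅ 𝟭 (ModuleCat.{u} B) :=
  NatIso.ofComponents (fun X => LinearEquiv.toModuleIso (LinearEquiv.ofBijective
      ({ toFun := pairingHom k X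
         map_add' := map_add _
         map_smul' := pairingHom_smul hk X } :
        BalancedTensor C P (BalancedTensor B Q X) →ₗ[B] X) (pairingHom_bijective hk' X)))
    fun f => ModuleCat.hom_ext (LinearMap.ext fun t => pairingHom_naturality k f.hom t)

open scoped ModuleCat.Algebra

/-- The two actions of `K` on `Q` agree, so a scalar can pass from `X` across the tensor sign to the
left side of `Q`. This makes the functor `K`-linear. -/
theorem lTensor_algebraMap_smul {X Y : Type u} [AddCommGroup X] [Module B X] [AddCommGroup Y]
    [Module B Y] (Q : CentralBimodule K C B) (f g : X →ₗ[B] Y) (r : K)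
    (hg : ∀ x, g x = algebraMap K B r • f x) (t : BalancedTensor B Q X) :
    BalancedTensor.lTensor C Q g t = algebraMap K C r • BalancedTensor.lTensor C Q f t := by
  refine BalancedTensor.induction B (p := fun t => BalancedTensor.lTensor C Q g t =
    algebraMap K C r • BalancedTensor.lTensor C Q f t) ?_ ?_ ?_ t
  · simp only [map_zero, smul_zero]
  · intro q x
    change tmul B q (g x) = tmul B (algebraMap K C r • q) (f x)
    rw [hg, ← smul_tmul, algebraMap_smul, ← MulOpposite.algebraMap_apply, algebraMap_smul]
  · intro t t' h h'
    simp only [map_add, smul_add, h, h']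

instance linear_tensorLeft (Q : CentralBimodule K C B) : (tensorLeft Q).Linear K where
  map_smul f r := ModuleCat.hom_ext (LinearMap.ext fun t =>
    lTensor_algebraMap_smul Q f.hom (r • f).hom r (fun _ => rfl) t)

/-- No compatibility between `k` and `l` is required: `Equivalence.mk` adjusts the unit so that the
triangle identity holds. -/
theorem isMoritaEquivalent_of_bijective
    (k : Hom (P.tensor Q) (regular K B)) (hk : Function.Bijective k.toLin)
    (l : Hom (Q.tensor P) (regular K C)) (hl : Function.Bijective l.toLin) :
    IsMoritaEquivalent K B C where
  cond := ⟨{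
    eqv := CategoryTheory.Equivalence.mk (tensorLeft Q) (tensorLeft P)
      (pairingIso (P := P) (Q := Q) k.toLin k.map_left hk).symm
      (pairingIso (P := Q) (Q := P) l.toLin l.map_left hl)
    linear := inferInstanceAs ((tensorLeft Q).Linear K) }⟩

end Morita

end CentralBimodule

/-! ### Almost isomorphisms of bimodules and the pairing through `A`. -/

namespace CentralBimodule

variable {K : Type v} [CommRing K] {A B C : Type u} [Ring A] [Algebra K A] [Ring B] [Algebra K B]
  [Ring C] [Algebra K C] {δ : DimFunction.{v, u} K} {n : EReal}

namespace Hom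

variable {X Y Z : CentralBimodule K A B}

/-- A homomorphism of bimodules whose kernel and cokernel are small on the right. -/
def IsAlmostIso (δ : DimFunction.{v, u} K) (n : EReal) (f : Hom X Y) : Prop :=
  _root_.IsAlmostIso δ n f.toLin

theorem IsAlmostIso.of_bijective (hδ : IsExactDimension δ Bᵐᵒᵖ) {f : Hom X Y}
    (hf : Function.Bijective f.toLin) : f.IsAlmostIso δ n :=
  _root_.IsAlmostIso.of_bijective hδ hf

theorem IsAlmostIso.comp (hδ : IsExactDimension δ Bᵐᵒᵖ) {g : Hom Y Z} {f : Hom X Y}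
    (hg : g.IsAlmostIso δ n) (hf : f.IsAlmostIso δ n) : (g.comp f).IsAlmostIso δ n :=
  _root_.IsAlmostIso.comp hδ hg hf

theorem IsAlmostIso.rTensor [IsNoetherianRing Bᵐᵒᵖ] (hγ : GammaCondition δ n 1 B C)
    (hδ : IsExactDimension δ Cᵐᵒᵖ) {N : CentralBimodule K B C} (hN : N.IsFG)
    (hX : Module.Finite Bᵐᵒᵖ X) (hY : Module.Finite Bᵐᵒᵖ Y) {f : Hom X Y}
    (hf : f.IsAlmostIso δ n) : (f.rTensor N).IsAlmostIso δ n :=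
  _root_.IsAlmostIso.rTensor hγ hδ hN hf

theorem IsAlmostIso.lTensor [IsNoetherianRing Aᵐᵒᵖ] (hδ : IsExactDimension δ Bᵐᵒᵖ)
    {M : CentralBimodule K C A} (hM : Module.Finite Aᵐᵒᵖ M) {f : Hom X Y}
    (hf : f.IsAlmostIso δ n) : (f.lTensor M).IsAlmostIso δ n :=
  _root_.IsAlmostIso.mapRight (X := M) hδ f.map_left hf

/-- Homomorphisms to a closed bimodule extend along almost isomorphisms. -/
theorem exists_extension (hZ : IsClosedModule δ n Bᵐᵒᵖ Z) (hX : Module.Finite Bᵐᵒᵖ X)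
    (hY : Module.Finite Bᵐᵒᵖ Y) {f : Hom X Y} (hf : f.IsAlmostIso δ n) (g : Hom X Z) :
    ∃ h : Hom Y Z, h.toLin ∘ₗ f.toLin = g.toLin := by
  obtain ⟨h, hh, -⟩ := hZ X Y hX hY f.toLin hf g.toLin
  have hh' : ∀ x, h (f.toLin x) = g.toLin x := LinearMap.congr_fun hh
  refine ⟨⟨h, fun a y => ?_⟩, hh⟩
  -- Left linearity comes from uniqueness: `y ↦ h (a • y)` and `y ↦ a • h y` both extend `a • g`
  -- along `f`.
  refine LinearMap.congr_fun ((hZ X Y hX hY f.toLin hf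
    (Module.toModuleEnd Bᵐᵒᵖ (S := A) Z a ∘ₗ g.toLin)).unique
    (y₁ := h ∘ₗ Module.toModuleEnd Bᵐᵒᵖ (S := A) Y a)
    (y₂ := Module.toModuleEnd Bᵐᵒᵖ (S := A) Z a ∘ₗ h) ?_ ?_) y
  · ext x
    change h (a • f.toLin x) = a • g.toLin x
    rw [← f.map_left, hh', g.map_left]
  · rw [LinearMap.comp_assoc, hh]

theorem exists_extension_isAlmostIso (hδ : IsExactDimension δ Bᵐᵒᵖ)
    (hZ : IsClosedModule δ n Bᵐᵒᵖ Z) (hX : Module.Finite Bᵐᵒᵖ X)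
    (hY : Module.Finite Bᵐᵒᵖ Y) {f : Hom X Y} (hf : f.IsAlmostIso δ n) {g : Hom X Z}
    (hg : g.IsAlmostIso δ n) : ∃ h : Hom Y Z, h.IsAlmostIso δ n := by
  obtain ⟨h, hh⟩ := exists_extension hZ hX hY hf g
  exact ⟨h, _root_.IsAlmostIso.of_comp hδ hf (hh ▸ hg)⟩

end Hom

variable {X Y : CentralBimodule K A B}

/-- The bimodule witnessing that finitely generated bimodules are `n`-isomorphic can be chosen
finitely generated. -/
theorem exists_finite_of_nIsomorphic [IsNoetherianRing Bᵐᵒᵖ] (hδ : IsExactDimension δ Bᵐᵒᵖ)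
    (hX : Module.Finite Bᵐᵒᵖ X) (hY : Module.Finite Bᵐᵒᵖ Y) (h : NIsomorphic δ n X Y) :
    ∃ (P : CentralBimodule K A B) (f : Hom X P) (g : Hom Y P), Module.Finite Bᵐᵒᵖ P ∧
      f.IsAlmostIso δ n ∧ g.IsAlmostIso δ n := by
  obtain ⟨P, f, g, hf, hg, hf₁, hf₂, hg₁, hg₂⟩ := h
  -- The sum of the two images is a finitely generated sub-bimodule of `P`, and the cokernels into
  -- it embed in the original ones. Closedness is a statement about finitely generated modules only.
  let S : Submodule Bᵐᵒᵖ P := LinearMap.range f ⊔ LinearMap.range g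
  have hS : ∀ (a : A), ∀ x ∈ S, a • x ∈ S := fun a x hx => by
    obtain ⟨_, ⟨x, rfl⟩, _, ⟨y, rfl⟩, rfl⟩ := Submodule.mem_sup.1 hx
    rw [smul_add, ← hf, ← hg]
    exact Submodule.add_mem_sup ⟨_, rfl⟩ ⟨_, rfl⟩
  have key : ∀ {W : CentralBimodule K A B} (w : W →ₗ[Bᵐᵒᵖ] P) (hw : LinearMap.range w ≤ S),
      δ Bᵐᵒᵖ (LinearMap.ker w) ≤ n → δ Bᵐᵒᵖ (P ⧸ LinearMap.range w) ≤ n →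
      _root_.IsAlmostIso δ n (w.codRestrict S fun x => hw ⟨x, rfl⟩) := by
    intro W w hw h₁ h₂
    constructor
    · rw [LinearMap.ker_codRestrict]
      exact h₁
    · refine hδ.le_of_injective (f := Submodule.mapQ _ (LinearMap.range w) S.subtype ?_) ?_ h₂
      · rintro _ ⟨x, rfl⟩
        exact ⟨x, rfl⟩
      · refine LinearMap.ker_eq_bot.1 (Submodule.ker_liftQ_eq_bot _ _ _ fun t ht => ?_)
        obtain ⟨x, hx⟩ := (Submodule.Quotient.mk_eq_zero _).1 ht
        exact ⟨x, Subtype.ext hx⟩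
  refine ⟨P.ofSubmodule S hS, ⟨f.codRestrict S fun x => le_sup_left (α := Submodule Bᵐᵒᵖ P) ⟨x, rfl⟩,
    fun a x => Subtype.ext (hf a x)⟩,
    ⟨g.codRestrict S fun x => le_sup_right (α := Submodule Bᵐᵒᵖ P) ⟨x, rfl⟩,
      fun a x => Subtype.ext (hg a x)⟩, ?_, key f le_sup_left hf₁ hf₂, key g le_sup_right hg₁ hg₂⟩
  refine Module.Finite.iff_fg.2 (Submodule.FG.sup ?_ ?_)
  · exact Module.Finite.iff_fg.1 (Module.Finite.range f)
  · exact Module.Finite.iff_fg.1 (Module.Finite.range g)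

/-- In `X → P ← Y` the second arrow is reversed by extending the identity of the closed module `Y`
along it. -/
theorem exists_hom_of_nIsomorphic [IsNoetherianRing Bᵐᵒᵖ] (hδ : IsExactDimension δ Bᵐᵒᵖ)
    (hX : Module.Finite Bᵐᵒᵖ X) (hY : Module.Finite Bᵐᵒᵖ Y) (hY' : IsClosedModule δ n Bᵐᵒᵖ Y)
    (h : NIsomorphic δ n X Y) : ∃ f : Hom X Y, f.IsAlmostIso δ n := by
  obtain ⟨P, f, g, hP, hf, hg⟩ := exists_finite_of_nIsomorphic hδ hX hY h
  obtain ⟨k, hk⟩ := Hom.exists_extension_isAlmostIso hδ hY' hY hP hg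
    (g := Hom.id Y) (.of_bijective hδ Function.bijective_id)
  exact ⟨k.comp f, hk.comp hδ hf⟩

/-- If `M₁ ⊗ N₁` is almost `B` and `N₂ ⊗ M₂` is almost `A`, then `(M₁ ⊗ N₂) ⊗ (M₂ ⊗ N₁)` is almost
`B`. -/
theorem exists_pairing [IsNoetherianRing Aᵐᵒᵖ] [IsNoetherianRing Bᵐᵒᵖ] [IsNoetherianRing Cᵐᵒᵖ]
    (hδA : IsExactDimension δ Aᵐᵒᵖ) (hδB : IsExactDimension δ Bᵐᵒᵖ) (hγ : GammaCondition δ n 1 A B)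
    (hB : IsClosedModule δ n Bᵐᵒᵖ B) {M₁ : CentralBimodule K B A} {N₁ : CentralBimodule K A B}
    {M₂ : CentralBimodule K C A} {N₂ : CentralBimodule K A C} (hM₁ : M₁.IsFG) (hN₁ : N₁.IsFG)
    (hM₂ : M₂.IsFG) (hN₂ : N₂.IsFG) (h₁ : NIsomorphic δ n (M₁.tensor N₁) (regular K B))
    (h₂ : NIsomorphic δ n (N₂.tensor M₂) (regular K A)) :
    ∃ e : Hom ((M₁.tensor N₂).tensor (M₂.tensor N₁)) (regular K B), e.IsAlmostIso δ n := by
  have hA' : Module.Finite Aᵐᵒᵖ (regular K A) := inferInstanceAs (Module.Finite Aᵐᵒᵖ A)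
  have hB' : Module.Finite Bᵐᵒᵖ (regular K B) := inferInstanceAs (Module.Finite Bᵐᵒᵖ B)
  obtain ⟨e₁, he₁⟩ := exists_hom_of_nIsomorphic hδB (hM₁.tensor hN₁).2 hB' hB h₁
  -- `A` is not assumed closed, so `N₂ ⊗ M₂ → P ← A` cannot yet be turned into a single map to `A`.
  obtain ⟨P, f, g, hP, hf, hg⟩ := exists_finite_of_nIsomorphic hδA (hN₂.tensor hM₂).2 hA' h₂
  have hMA := finite_tensor M₁ (regular K A) hM₁.2 hA'
  have hMP := finite_tensor M₁ P hM₁.2 hP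
  have hMNM := finite_tensor M₁ (N₂.tensor M₂) hM₁.2 (hN₂.tensor hM₂).2
  -- After tensoring with `M₁` and `N₁` the target is the closed module `B`: `(M₁ ⊗ A) ⊗ N₁ ≅ M₁ ⊗
  -- N₁ → B` extends to `(M₁ ⊗ P) ⊗ N₁`. This reverses the arrow out of `A`.
  obtain ⟨E, hE⟩ := Hom.exists_extension_isAlmostIso hδB (Z := regular K B) hB
    (finite_tensor _ N₁ hMA hN₁.2) (finite_tensor _ N₁ hMP hN₁.2)
    ((hg.lTensor hδA hM₁.2).rTensor hγ hδB hN₁ hMA hMP)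
    (he₁.comp hδB (Hom.IsAlmostIso.rTensor hγ hδB hN₁ hMA hM₁.2
      (.of_bijective hδA (Hom.rid_bijective M₁))))
  refine ⟨_, hE.comp hδB (((hf.lTensor hδA hM₁.2).rTensor hγ hδB hN₁ hMNM hMP).comp hδB
    ((Hom.IsAlmostIso.rTensor hγ hδB hN₁ ((hM₁.tensor hN₂).tensor hM₂).2 hMNM
      (.of_bijective hδA (Hom.assoc_bijective M₁ N₂ M₂))).comp hδB
      (.of_bijective hδB (Hom.inv_bijective _
        (Hom.assoc_bijective (M₁.tensor N₂) M₂ N₁)))))⟩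

end CentralBimodule

/-! ### Projective hulls of almost invertible bimodules. -/

namespace CentralBimodule

variable {K : Type v} [CommRing K] {B C : Type u} [Ring B] [Algebra K B]
  [Ring C] [Algebra K C] {δ : DimFunction.{v, u} K} {n : EReal}

/-- The elements of `M` killed by all functionals `φ(x ⊗ -)`. -/
def pairingKernel {M : CentralBimodule K B C} {N : CentralBimodule K C B}
    (φ : Hom (N.tensor M) (regular K C)) : Submodule Cᵐᵒᵖ M where
  carrier := {m | ∀ x : N, φ.toLin (tmul B x m) = 0}
  zero_mem' x := by rw [tmul_zero]; exact map_zero φ.toLin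
  add_mem' {m m'} h h' x := by
    rw [tmul_add]
    exact (map_add φ.toLin _ _).trans (by rw [h x, h' x, add_zero])
  smul_mem' c m h x := by
    refine (φ.toLin.map_smul c (tmul B x m)).trans ?_
    rw [h x, smul_zero]

theorem smul_mem_pairingKernel {M : CentralBimodule K B C} {N : CentralBimodule K C B}
    (φ : Hom (N.tensor M) (regular K C)) (b : B) (m : M) (hm : m ∈ pairingKernel φ) :
    b • m ∈ pairingKernel φ := fun x => by
  rw [← smul_tmul]
  exact hm _

/-- Each `φ(x ⊗ -)` is an element of the dual of `M`. -/
theorem ker_doubleDualEval_le_pairingKernel {M : CentralBimodule K B C} {N : CentralBimodule K C B}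
    (φ : Hom (N.tensor M) (regular K C)) :
    LinearMap.ker (doubleDualEval C M) ≤ pairingKernel φ := fun m hm x => by
  let f : M →ₗ[Cᵐᵒᵖ] C :=
    { toFun := fun m => φ.toLin (tmul B x m)
      map_add' := fun m m' => by rw [tmul_add]; exact map_add φ.toLin _ _
      map_smul' := fun c m => φ.toLin.map_smul c (tmul B x m) }
  exact LinearMap.congr_fun hm f

/-- A bimodule with an almost inverse embeds into its double dual up to a small kernel. -/
theorem ker_doubleDualEval_le [IsNoetherianRing B] [IsNoetherianRing Cᵐᵒᵖ]
    (hδ : IsExactDimension δ Cᵐᵒᵖ)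
    (hγ : GammaCondition δ n 1 B C) {M : CentralBimodule K B C} {N : CentralBimodule K C B}
    (hM : M.IsFG) {e : Hom (M.tensor N) (regular K B)} (he : e.IsAlmostIso δ n)
    {φ : Hom (N.tensor M) (regular K C)} (hφ : φ.IsAlmostIso δ n) :
    δ Cᵐᵒᵖ (LinearMap.ker (doubleDualEval C M)) ≤ n := by
  -- There are two maps `(M ⊗ N) ⊗ M → M`: `θ` contracts the last two factors with `φ`, `ρ` the
  -- first two with `e`. With `L` the pairing kernel, `θ` kills every `t ⊗ l` with `l` in `L`, so `ρ
  -- (ker θ)`, which is small, contains `E L`, where `E` is the image of `e`. The quotient `L / E L`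
  -- is a quotient of `(B / E) ⊗ L`, small by γ. Hence `L` is small. No compatibility of `e` and `φ`
  -- is used.
  let θ : Hom ((M.tensor N).tensor M) M :=
    (Hom.rid M).comp ((φ.lTensor M).comp (Hom.assoc M N M))
  have hθ : θ.IsAlmostIso δ n := .comp hδ (.of_bijective hδ (Hom.rid_bijective M))
    ((hφ.lTensor hδ hM.2).comp hδ (.of_bijective hδ (Hom.assoc_bijective M N M)))
  let ρ : Hom ((M.tensor N).tensor M) M := (Hom.lid M).comp (e.rTensor M)
  let J : Submodule Cᵐᵒᵖ M := (LinearMap.ker θ.toLin).map ρ.toLin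
  have hJ : δ Cᵐᵒᵖ J ≤ n := hδ.map_le _ hθ.ker_le
  let L := M.ofSubmodule (pairingKernel φ) (smul_mem_pairingKernel φ)
  have hL : L.IsFG := ofSubmodule_isFG hM _ _
  have hθ0 : ∀ (t : M.tensor N) (l : L), θ.toLin (tmul B t l.1) = 0 := fun t l => by
    refine BalancedTensor.induction C (p := fun t => θ.toLin (tmul B t l.1) = 0) ?_ ?_ ?_ t
    · exact (congrArg θ.toLin (zero_tmul B (M := M.tensor N) l.1)).trans (map_zero θ.toLin)
    · intro m x
      exact (congrArg (fun c : C => op c • m) (l.2 x)).trans (zero_smul Cᵐᵒᵖ m)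
    · intro t t' h h'
      refine (congrArg θ.toLin (add_tmul B (M := M.tensor N) t t' l.1)).trans ?_
      exact (map_add θ.toLin _ _).trans ((congrArg₂ (· + ·) h h').trans (add_zero (0 : M)))
  let e' : M.tensor N →ₗ[Bᵐᵒᵖ] B := e.toLin
  let E : Submodule Bᵐᵒᵖ B := LinearMap.range e'
  have hsmall : δ Cᵐᵒᵖ (BalancedTensor B (B ⧸ E) L) ≤ n := hγ.tensor_le hδ hL he.coker_le
  have hmem : ∀ s : BalancedTensor B (M.tensor N) L,
      ((Hom.lid L).toLin (BalancedTensor.map B e.toLin LinearMap.id s)).1 ∈ J := fun s => by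
    refine BalancedTensor.induction B (p := fun s =>
      ((Hom.lid L).toLin (BalancedTensor.map B e.toLin LinearMap.id s)).1 ∈ J) ?_ ?_ ?_ s
    · exact J.zero_mem
    · intro t l
      exact ⟨tmul B t l.1, hθ0 t l, rfl⟩
    · intro s s' h h'
      have hadd := (congrArg (fun t => ((Hom.lid L).toLin t).1)
        (map_add (BalancedTensor.map B e.toLin (LinearMap.id : L →ₗ[B] L)) s s')).trans
        (congrArg Subtype.val (map_add (Hom.lid L).toLin _ _))
      exact (congrArg (· ∈ J) hadd).mpr (J.add_mem h h')
  have hLδ : δ Cᵐᵒᵖ L ≤ n := by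
    -- The kernel of `B ⊗ L → (B / E) ⊗ L` is the image of `(M ⊗ N) ⊗ L`, which the action map sends
    -- into `J`.
    refine hδ.le_of_surjective_of_map_ker (Hom.lid L).toLin
      (BalancedTensor.rTensor Cᵐᵒᵖ L E.mkQ) (Hom.lid_bijective L).2 ?_ hsmall
    refine hδ.le_of_injective (f := (pairingKernel φ).subtype.restrict
      (q := J) ?_) ?_ hJ
    · rintro _ ⟨t, ht, rfl⟩
      obtain ⟨s, rfl⟩ := exists_of_map_left_eq_zero (f := e') (f' := E.mkQ)
        (LinearMap.exact_map_mkQ_range e') (Submodule.mkQ_surjective _) t ht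
      exact hmem s
    · intro x y h
      exact Subtype.ext (Subtype.ext (congrArg (fun z : J => (z : M)) h))
  exact hδ.submodule_mono (ker_doubleDualEval_le_pairingKernel φ) hLδ

/-- The action of `B` on the dual of a `(B, C)`-bimodule. -/
def dualEnd (M : CentralBimodule K B C) (b : B) : (M →ₗ[Cᵐᵒᵖ] C) →ₗ[C] (M →ₗ[Cᵐᵒᵖ] C) where
  toFun f := f ∘ₗ Module.toModuleEnd Cᵐᵒᵖ (S := B) M b
  map_add' _ _ := rfl
  map_smul' _ _ := rfl

theorem dualEnd_apply (M : CentralBimodule K B C) (b : B) (f : M →ₗ[Cᵐᵒᵖ] C) (m : M) :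
    dualEnd M b f m = f (b • m) := rfl

/-- The double dual of a `(B, C)`-bimodule with respect to `C`. -/
def doubleDual (M : CentralBimodule K B C) : CentralBimodule K B C :=
  letI : Module B (DoubleDual C M) :=
    { smul := fun b x => x ∘ₗ dualEnd M b
      one_smul := fun x => LinearMap.ext fun f => congrArg x <| LinearMap.ext fun m =>
        congrArg f (one_smul B m)
      mul_smul := fun b b' x => LinearMap.ext fun f => congrArg x <| LinearMap.ext fun m =>
        congrArg f (mul_smul b b' m)
      smul_zero := fun _ => rfl
      smul_add := fun _ _ _ => rfl
      add_smul := fun b b' x => LinearMap.ext fun f => by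
        refine (congrArg x <| LinearMap.ext fun m => ?_).trans (map_add x _ _)
        exact (congrArg f (add_smul b b' m)).trans (map_add f _ _)
      zero_smul := fun x => LinearMap.ext fun f => by
        refine (congrArg x <| LinearMap.ext fun m => ?_).trans (map_zero x)
        exact (congrArg f (zero_smul B m)).trans (map_zero f) }
  { carrier := DoubleDual C M
    smulComm := ⟨fun _ _ _ => rfl⟩
    towerRight := inferInstance
    -- `K` acts on the double dual through the values in `C`. Linearity of functionals over `C` and
    -- centrality of `K` in `C` identify this with the action through `B`.
    towerLeft := .mk fun k b x => LinearMap.ext fun f => by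
      change x (dualEnd M (k • b) f) = k • x (dualEnd M b f)
      rw [← algebraMap_smul C k (x _), ← map_smul]
      refine congrArg x <| LinearMap.ext fun m => ?_
      rw [dualEnd_apply, LinearMap.smul_apply, dualEnd_apply, smul_assoc,
        ← algebraMap_smul Cᵐᵒᵖ k (b • m), map_smul, MulOpposite.algebraMap_apply,
        op_smul_eq_mul, smul_eq_mul, Algebra.commutes] }

/-- The evaluation map as a bimodule homomorphism. -/
def evalHom (M : CentralBimodule K B C) : Hom M M.doubleDual :=
  ⟨doubleDualEval C M, fun _ _ => rfl⟩

/-- A bimodule with an almost inverse is almost isomorphic to its double dual, which is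
projective on the right. -/
theorem exists_projective_hull [IsNoetherianRing B] [IsNoetherianRing C] [IsNoetherianRing Cᵐᵒᵖ]
    (hδ : IsExactDimension δ C) (hδ' : IsExactDimension δ Cᵐᵒᵖ)
    (hγ : GammaCondition δ (δ.alg C - 2) 1 B C) (hCM : IsDimCM δ C) (hAR : IsAuslanderRegular C)
    (hd : δ.alg C ≤ 2) {M : CentralBimodule K B C} {N : CentralBimodule K C B}
    (hM : M.IsFG) {e : Hom (M.tensor N) (regular K B)} (he : e.IsAlmostIso δ (δ.alg C - 2))
    {φ : Hom (N.tensor M) (regular K C)} (hφ : φ.IsAlmostIso δ (δ.alg C - 2)) :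
    ∃ (P : CentralBimodule K B C) (η : Hom M P), Module.Finite Cᵐᵒᵖ P ∧ Module.Projective Cᵐᵒᵖ P ∧
      η.IsAlmostIso δ (δ.alg C - 2) := by
  have := hM.2
  obtain ⟨hfin, hproj⟩ := hCM.projective_dual hAR hδ hd (M →ₗ[Cᵐᵒᵖ] C)
  exact ⟨M.doubleDual, M.evalHom, hfin, hproj, ker_doubleDualEval_le hδ' hγ hM he hφ,
    hCM.doubleDualEval_coker_le hAR hδ hδ' hd⟩

/-- Projective bimodules almost isomorphic to mutually almost inverse bimodules pair to an
isomorphism. -/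
theorem exists_bijective_pairing [IsNoetherianRing Bᵐᵒᵖ] [IsNoetherianRing Cᵐᵒᵖ]
    (hδ : IsExactDimension δ Bᵐᵒᵖ)
    (hγ : GammaCondition δ (δ.alg B - 2) 1 C B) (hCM : IsDimCM δ B)
    {M P : CentralBimodule K B C} {N Q : CentralBimodule K C B} (hM : M.IsFG) (hN : N.IsFG)
    (hP : Module.Finite Cᵐᵒᵖ P) (hQ : Module.Finite Bᵐᵒᵖ Q) (hP' : Module.Projective Cᵐᵒᵖ P)
    (hQ' : Module.Projective Bᵐᵒᵖ Q) {η : Hom M P} (hη : η.IsAlmostIso δ (δ.alg B - 2))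
    {ψ : Hom N Q} (hψ : ψ.IsAlmostIso δ (δ.alg B - 2)) {e : Hom (M.tensor N) (regular K B)}
    (he : e.IsAlmostIso δ (δ.alg B - 2)) :
    ∃ k : Hom (P.tensor Q) (regular K B), Function.Bijective k.toLin := by
  have hB := hCM.isClosedModule_self hδ
  have hPQ := finite_tensor P Q hP hQ
  have hPQ' : Module.Projective Bᵐᵒᵖ (P.tensor Q) :=
    projective_right (A := C) (P := P) (Q := Q) (S := Bᵐᵒᵖ)
  have hfin : Module.Finite Bᵐᵒᵖ (regular K B) := inferInstanceAs (Module.Finite Bᵐᵒᵖ B)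
  -- `e` is extended along `M ⊗ N → P ⊗ N → P ⊗ Q`. The extension is an almost isomorphism from a
  -- projective module to `B`, both closed, hence bijective.
  obtain ⟨k, hk⟩ := Hom.exists_extension_isAlmostIso hδ (Z := regular K B) hB (hM.tensor hN).2 hPQ
    ((hψ.lTensor hδ hP).comp hδ (hη.rTensor hγ hδ hN hM.2 hP)) he
  exact ⟨k, (hCM.isClosedModule_of_projective hδ).bijective_of_isAlmostIso hB hk⟩

end CentralBimodule

/-! ### The equivalence of the two resolutions. -/

theorem theorem4p2 {K : Type v} [CommRing K] (𝒜 : AlgebraClass.{v, u} K) (δ : DimFunction.{v, u} K)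
    (h : StandingHypothesis 𝒜 δ)
    (A B₁ B₂ : Type u) [Ring A] [Algebra K A] [Ring B₁] [Algebra K B₁] [Ring B₂] [Algebra K B₂]
    (hA : 𝒜.Mem A) (hdim : δ.alg A ≤ 2)
    (M₁ : CentralBimodule K B₁ A) (N₁ : CentralBimodule K A B₁) (h₁ : IsNQR 𝒜 δ A B₁ M₁ N₁)
    (M₂ : CentralBimodule K B₂ A) (N₂ : CentralBimodule K A B₂) (h₂ : IsNQR 𝒜 δ A B₂ M₂ N₂) :
    IsMoritaEquivalent K B₁ B₂ := by
  have := 𝒜.noetherian_right A hA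
  have := 𝒜.noetherian_left B₁ h₁.mem
  have := 𝒜.noetherian_right B₁ h₁.mem
  have := 𝒜.noetherian_left B₂ h₂.mem
  have := 𝒜.noetherian_right B₂ h₂.mem
  have hδA := h.exact_right A hA
  have hδ₁ := h.exact_right B₁ h₁.mem
  have hδ₂ := h.exact_right B₂ h₂.mem
  -- All three algebras have the same dimension, so small means the same over each of them.
  have hn₁ : δ.alg A - 2 = δ.alg B₁ - 2 := by rw [h₁.dim_eq]
  have hn₂ : δ.alg A - 2 = δ.alg B₂ - 2 := by rw [h₂.dim_eq]
  have hn : δ.alg B₁ - 2 = δ.alg B₂ - 2 := hn₁.symm.trans hn₂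
  have hγ₁₂ := h.gamma B₁ B₂ h₁.mem h₂.mem (h₁.dim_eq.trans h₂.dim_eq.symm)
  have hγ₂₁ := h.gamma B₂ B₁ h₂.mem h₁.mem (h₂.dim_eq.trans h₁.dim_eq.symm)
  obtain ⟨e, he⟩ := CentralBimodule.exists_pairing hδA hδ₁ (h.gamma A B₁ hA h₁.mem h₁.dim_eq.symm)
    (hn₁ ▸ h₁.cohenMacaulay.isClosedModule_self hδ₁) h₁.fg_left h₁.fg_right h₂.fg_left h₂.fg_right
    h₁.iso_left h₂.iso_right
  obtain ⟨φ, hφ⟩ := CentralBimodule.exists_pairing hδA hδ₂ (h.gamma A B₂ hA h₂.mem h₂.dim_eq.symm)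
    (hn₂ ▸ h₂.cohenMacaulay.isClosedModule_self hδ₂) h₂.fg_left h₂.fg_right h₁.fg_left h₁.fg_right
    h₂.iso_left h₁.iso_right
  -- The almost inverse bimodules are M = M₁ ⊗ N₂ and N = M₂ ⊗ N₁. Each is paired with the other in
  -- both orders, which allows a projective hull of M over B₂ and of N over B₁.
  have hM := h₁.fg_left.tensor h₂.fg_right
  have hN := h₂.fg_left.tensor h₁.fg_right
  obtain ⟨P, η, hP, hP', hη⟩ := CentralBimodule.exists_projective_hull (h.exact_left B₂ h₂.mem) hδ₂
    (hn ▸ hγ₁₂) h₂.cohenMacaulay h₂.auslanderRegular (h₂.dim_eq.trans_le hdim) hM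
    (hn₂ ▸ he) (hn₂ ▸ hφ)
  obtain ⟨Q, ψ, hQ, hQ', hψ⟩ := CentralBimodule.exists_projective_hull (h.exact_left B₁ h₁.mem) hδ₁
    (hn ▸ hγ₂₁) h₁.cohenMacaulay h₁.auslanderRegular (h₁.dim_eq.trans_le hdim) hN
    (hn₁ ▸ hφ) (hn₁ ▸ he)
  obtain ⟨k, hk⟩ := CentralBimodule.exists_bijective_pairing hδ₁ (hn ▸ hγ₂₁) h₁.cohenMacaulay
    hM hN hP hQ hP' hQ' (hn ▸ hη) hψ (hn₁ ▸ he)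
  obtain ⟨l, hl⟩ := CentralBimodule.exists_bijective_pairing hδ₂ (hn ▸ hγ₁₂) h₂.cohenMacaulay
    hN hM hQ hP hQ' hP' (hn ▸ hψ) hη (hn₂ ▸ hφ)
  exact CentralBimodule.isMoritaEquivalent_of_bijective k hk l hl
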